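/- Let $d\ge 0$ and let $(J_{x,y})$ be real coupling constants indexed by unordered pairs $\{x,y\}$ of points of $\mathbb{Z}^d$, such that: $J_{x,y}=J_{0,y-x}$ for all $x,y$; $J_{x,y}\ge 0$; $\sum_{x\in\mathbb{Z}^d}J_{0,x}<\infty$; and for every $x\in\mathbb{Z}^d$ there are $0=x_0,x_1,\dots,x_m=x$ with $J_{x_{i},x_{i+1}}>0$ for all $0\le i<m$. Let $\beta>0$. For a set $V$ let $\mathcal{P}_2(V)$ be the set of unordered pairs (edges) $\{x,y\}$ of distinct points of $V$ and $\Omega_V=\{0,1,2,\dots\}^{\mathcal{P}_2(V)}$ the set of currents on $V$, with the product $\sigma$-algebra. Let $G\subset\mathbb{Z}^d$ be finite, let $\delta\notin\mathbb{Z}^d$ be an additional vertex, and set $J_{x,\delta}=\sum_{y\in\mathbb{Z}^d\setminus G}J_{x,y}$ for $x\in G$. For a current $\mathbf n$ on $V=G$ or $V=G\cup\{\delta\}$ put $w_\beta(\mathbf n)=\prod_{e\in\mathcal{P}_2(V)}(\beta J_e)^{\mathbf n_e}/\mathbf n_e!$ and let $\partial\mathbf n$ be the set of the $x\in G$ for which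 $\sum_{y\in V\setminus\{x\}}\mathbf n_{x,y}$ is odd ($\delta$ is never counted as a source). Let $\mathrm P^0_{G,\beta}$, respectively $\mathrm P^+_{G,\beta}$, be the probability measure on $\Omega_G$, respectively on $\Omega_{G\cup\{\delta\}}$, that is supported on $\{\partial\mathbf n=\emptyset\}$ and gives each $\mathbf n$ there a probability proportional to $w_\beta(\mathbf n)$. Let $\widehat{\mathrm P}^0_{G,\beta}$ and $\widehat{\mathrm P}^+_{G,\beta}$ be the laws on $\Omega_{\mathbb{Z}^d}$ that these induce when the values on the edges containing $\delta$ are forgotten and currents on $G$ are extended by $0$ to the pairs of $\mathbb{Z}^d$ not contained in $G$. Let $\Lambda_L=[-L,L]^d\cap\mathbb{Z}^d$, and for $x\in\mathbb{Z}^d$ define the shift $\tau_x$ by $\tau_x(\omega)_{a,b}=\omega_{a+x,b+x}$. Then there are two probability measures $\widehat{\mathrm P}^+_\beta$ and $\widehat{\mathrm P}^0_\beta$ on $\Omega_{\mathbb{Z}^d}$ such that, for $\#\in\{+,0\}$: 1. (Convergence) for every event $\mathcal A\subset\Omega_{\mathbb{Z}^d}$ depending on finitely many edges, $\lim_{L\to\infty}\widehat{\mathrm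 P}^\#_{\Lambda_L,\beta}[\mathcal A]=\widehat{\mathrm P}^\#_\beta[\mathcal A]$; 2. (Translation invariance) $\widehat{\mathrm P}^\#_\beta$ is invariant under $\tau_x$ for every $x\in\mathbb{Z}^d$; 3. (Ergodicity) $\widehat{\mathrm P}^\#_\beta$ is ergodic with respect to the group of shifts $(\tau_x)_{x\in\mathbb{Z}^d}$. The same three properties hold for the laws of the traced currents, that is, with all the measures above replaced by their images on $\{0,1\}^{\mathcal{P}_2(\mathbb{Z}^d)}$ under the map $\mathbf n\mapsto(\mathbf 1\{\mathbf n_e>0\})_{e}$. -/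

import Mathlib

open MeasureTheory Filter Topology
open scoped Nat

noncomputable section

namespace RandomCurrent

/-- The vertices of the lattice `ℤ^d`. -/
abbrev Site (d : ℕ) : Type := Fin d → ℤ

/-- The unordered pairs `{x, y}`, `x ≠ y`, of elements of `V`. -/
abbrev Edge (V : Type) : Type := {e : Sym2 V // ¬ e.IsDiag}

/-- The map on edges induced by an injection on vertices. -/
def Edge.map {V W : Type} (f : V ↪ W) (e : Edge V) : Edge W :=
  ⟨e.1.map f, fun h => e.2 ((Sym2.isDiag_map f.injective).1 h)⟩

/-- Currents on `V`: integer valued functions of the edges. -/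
abbrev Current (V : Type) : Type := Edge V → ℕ

/-- Percolation configurations on `V`: `true` means open, `false` closed. -/
abbrev Percolation (V : Type) : Type := Edge V → Bool

/-- The trace of a current: an edge is open when the current through it is positive. -/
def trace {V : Type} (n : Current V) : Percolation V := fun e => decide (0 < n e)

/-- The conditions on the coupling constants, which are indexed by unordered pairs. -/
structure IsCoupling {d : ℕ} (J : Sym2 (Site d) → ℝ) : Prop where
  /-- translation invariant -/
  translation : ∀ x y : Site d, J s(x, y) = J s(0, y - x)
  /-- ferromagnetic -/
  nonneg : ∀ x y : Site d, 0 ≤ J s(x, y)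
  /-- locally finite -/
  summable : Summable fun x : Site d => J s(0, x)
  /-- aperiodic: every vertex is reached from `0` by steps of positive coupling -/
  aperiodic : ∀ x : Site d, Relation.ReflTransGen (fun a b => 0 < J s(a, b)) 0 x

section FiniteGraph

variable {V : Type} [Fintype V] [DecidableEq V]

/-- The sources of a current: the vertices at which the total current is odd. -/
def sources (n : Current V) : Set V :=
  {x | Odd (∑ e : Edge V, if x ∈ e.1 then n e else 0)}

/-- The weight `∏ (β K_e)^{n_e} / n_e!` of a current. -/
def weight (β : ℝ) (K : Edge V → ℝ) (n : Current V) : ℝ :=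
  ∏ e : Edge V, (β * K e) ^ n e / (n e)!

/-- The law on currents in `S` with probabilities proportional to the weights. -/
def lawOn (β : ℝ) (K : Edge V → ℝ) (S : Set (Current V)) : Measure (Current V) :=
  Measure.sum fun n : Current V =>
    ENNReal.ofReal (S.indicator (weight β K) n / ∑' m : Current V, S.indicator (weight β K) m) •
      Measure.dirac n

end FiniteGraph

section FiniteVolume

variable {d : ℕ} (J : Sym2 (Site d) → ℝ) (β : ℝ) (G : Finset (Site d))

/-- The coupling constants between the vertices of `G`. -/
def freeCoupling (e : Edge G) : ℝ := J (e.1.map Subtype.val)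

/-- The coupling `∑_{y ∉ G} J_{x,y}` of a vertex `x` of `G` to the ghost vertex. -/
def ghostCoupling (x : Site d) : ℝ := ∑' y : {y : Site d // y ∉ G}, J s(x, y.1)

/-- The coupling constants on `G ∪ {δ}`; the ghost vertex `δ` is `none`. -/
def plusCoupling (e : Edge (Option G)) : ℝ :=
  Sym2.lift ⟨fun a b : Option G =>
    match a, b with
    | some x, some y => J s(x.1, y.1)
    | some x, none => ghostCoupling J G x.1
    | none, some y => ghostCoupling J G y.1
    | none, none => 0, by
      rintro (_ | x) (_ | y)
      · rfl
      · rfl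
      · rfl
      · exact congrArg J Sym2.eq_swap⟩ e.1

/-- The law of sourceless currents on `G`. -/
def freeLaw : Measure (Current G) :=
  lawOn β (freeCoupling J G) {n | sources n = ∅}

/-- The law of sourceless currents on `G ∪ {δ}`, where `δ` is never listed among the sources. -/
def plusLaw : Measure (Current (Option G)) :=
  lawOn β (plusCoupling J G) {n | {x : G | some x ∈ sources n} = ∅}

/-- A current on `G` as a current on `ℤ^d` that vanishes on the pairs not contained in `G`. -/
def extendCurrent (n : Current G) : Current (Site d) :=
  Function.extend (Edge.map (Function.Embedding.subtype (· ∈ G))) n 0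

/-- The restriction to the pairs of `G` of a current on `G ∪ {δ}`. -/
def forgetGhost (n : Current (Option G)) : Current G :=
  fun e => n (e.map Function.Embedding.some)

/-- The box `[-L, L]^d`. -/
def box (d L : ℕ) : Finset (Site d) := Finset.Icc (fun _ => -(L : ℤ)) (fun _ => (L : ℤ))

/-- The law of the random current in the box with free boundary conditions, as a law on currents
on `ℤ^d`. -/
def freeBoxLaw (L : ℕ) : Measure (Current (Site d)) :=
  (freeLaw J β (box d L)).map (extendCurrent (box d L))

/-- The law on the lattice edges of the random current in the box with `+` boundary conditions,
as a law on currents on `ℤ^d`. -/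
def plusBoxLaw (L : ℕ) : Measure (Current (Site d)) :=
  (plusLaw J β (box d L)).map fun n => extendCurrent (box d L) (forgetGhost (box d L) n)

end FiniteVolume

section InfiniteVolume

variable {d : ℕ} {S : Type}

/-- The shift `(τ_x ω)_{a,b} = ω_{a+x,b+x}`. -/
def shift (x : Site d) (ω : Edge (Site d) → S) : Edge (Site d) → S :=
  fun e => ω (e.map (Equiv.addRight x).toEmbedding)

/-- The action of `ℤ^d` on configurations by shifts. -/
abbrev shiftAction (d : ℕ) (S : Type) : VAdd (Site d) (Edge (Site d) → S) := ⟨shift⟩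

/-- `μ` is a translation invariant and ergodic law, and `ν L` converges to it, as `L → ∞`, on the
events that depend on finitely many edges. -/
structure IsErgodicLimit [MeasurableSpace S] (ν : ℕ → Measure (Edge (Site d) → S))
    (μ : Measure (Edge (Site d) → S)) : Prop where
  isProbability : IsProbabilityMeasure μ
  convergence : ∀ (E : Finset (Edge (Site d))) (A : Set (Edge (Site d) → S)),
    DependsOn (fun ω => ω ∈ A) (E : Set (Edge (Site d))) →
      Tendsto (fun L => ν L A) atTop (𝓝 (μ A))
  invariance : ∀ x : Site d, MeasurePreserving (shift x) μ μ
  ergodicity : letI := shiftAction d S; ErgodicVAdd (Site d) (Edge (Site d) → S) μ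

end InfiniteVolume

end RandomCurrent

end

/-!
Write `exp (β J_e σ_x σ_y)` as a power series and average over the spins: the probability that the
current agrees with `m` on `E` becomes the mean, in an Ising model, of a linear combination of
products of edge spins. The plus boundary condition acts as a magnetic field. By Ginibre's
inequality the correlations of edge spins are monotone in the volume, so they converge and their
limits are translation invariant. Tail bounds on the edge values, uniform in the volume, exclude a
loss of mass, and the limits of the cylinder probabilities define a probability measure.

For ergodicity, multiply the Ising weight by `∏ (1 + a σ_{S y})`, where the `σ_{S y}` are the
products of edge spins over disjoint translates of an edge set. For small `a`, by Ginibre's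
inequality, this changes correlations by no more than a small change of `β` does. As a monotone
limit of continuous functions of `β`, the limiting correlation is semicontinuous from the side to
which `β` is moved, so the change is small, and sums of the `σ_{S y}` have nearly the exponential
moments of sums of independent variables. Averages of the `σ_{S y}` therefore concentrate around
the limiting correlation, and averages of translated cylinder events around a constant. Hence
every invariant event is independent of every cylinder event, and so of itself.
-/

noncomputable section

namespace RandomCurrent

/-! ### Functions of positive type -/

/-- The inclusion of the signs into the real numbers. -/
def sgn : ℤˣ →* ℝ := (Int.castRingHom ℝ : ℤ →* ℝ).comp (Units.coeHom ℤ)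

@[simp] lemma sgn_neg_one : sgn (-1) = -1 := by simp [sgn]

lemma sgn_eq_one_or (u : ℤˣ) : sgn u = 1 ∨ sgn u = -1 := by
  rcases Int.units_eq_one_or u with rfl | rfl <;> simp

@[simp] lemma abs_sgn (u : ℤˣ) : |sgn u| = 1 := by rcases sgn_eq_one_or u with h | h <;> simp [h]

lemma sgn_le_one (u : ℤˣ) : sgn u ≤ 1 := (le_abs_self _).trans (abs_sgn u).le

@[simp] lemma sgn_mul_self (u : ℤˣ) : sgn u * sgn u = 1 := by
  rcases sgn_eq_one_or u with h | h <;> simp [h]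

lemma exp_mul_sgn (c : ℝ) (u : ℤˣ) :
    Real.exp (c * sgn u) = Real.cosh c + Real.sinh c * sgn u := by
  rcases sgn_eq_one_or u with h | h <;> rw [h]
  · rw [mul_one, mul_one, Real.cosh_add_sinh]
  · rw [mul_neg_one, mul_neg_one, ← sub_eq_add_neg, Real.cosh_sub_sinh]

lemma exp_mul_sgn_sub_tanh_mul (c : ℝ) (u : ℤˣ) :
    Real.exp (c * sgn u) - Real.tanh c * (sgn u * Real.exp (c * sgn u)) = 1 / Real.cosh c := by
  have hcosh := (Real.cosh_pos c).ne'
  rw [exp_mul_sgn, Real.tanh_eq_sinh_div_cosh]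
  field_simp
  linear_combination Real.cosh_sq c - Real.sinh c ^ 2 * sgn_mul_self u

section PosType

variable {X ι : Type*} [CommGroup X]

/-- The functions on a group that are nonnegative combinations of `±1`-valued characters. They
are closed under products, and their sums over finite subgroups are nonnegative. -/
def posType (X : Type*) [CommGroup X] : Subalgebra NNReal (X → ℝ) :=
  Algebra.adjoin NNReal (Set.range fun (χ : X →* ℤˣ) (σ : X) => sgn (χ σ))

lemma sgn_comp_mem_posType (χ : X →* ℤˣ) : (fun σ => sgn (χ σ)) ∈ posType X :=
  Algebra.subset_adjoin ⟨χ, rfl⟩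

lemma const_mul_mem_posType {c : ℝ} (hc : 0 ≤ c) {f : X → ℝ} (hf : f ∈ posType X) :
    (fun σ => c * f σ) ∈ posType X :=
  (posType X).smul_mem hf (⟨c, hc⟩ : NNReal)

lemma const_mem_posType {c : ℝ} (hc : 0 ≤ c) : (fun _ => c) ∈ posType X := by
  simpa using const_mul_mem_posType hc (one_mem (posType X))

lemma mul_mem_posType {f g : X → ℝ} (hf : f ∈ posType X) (hg : g ∈ posType X) :
    (fun σ => f σ * g σ) ∈ posType X := mul_mem hf hg

lemma add_mem_posType {f g : X → ℝ} (hf : f ∈ posType X) (hg : g ∈ posType X) :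
    (fun σ => f σ + g σ) ∈ posType X := add_mem hf hg

lemma prod_mem_posType {s : Finset ι} {f : ι → X → ℝ} (hf : ∀ i ∈ s, f i ∈ posType X) :
    (fun σ => ∏ i ∈ s, f i σ) ∈ posType X := by
  rw [← Finset.prod_fn]
  exact prod_mem hf

lemma exp_mul_sgn_mem_posType {c : ℝ} (hc : 0 ≤ c) (χ : X →* ℤˣ) :
    (fun σ => Real.exp (c * sgn (χ σ))) ∈ posType X := by
  simp_rw [exp_mul_sgn]
  exact add_mem_posType (const_mem_posType (Real.cosh_pos c).le)
    (const_mul_mem_posType (Real.sinh_nonneg_iff.2 hc) (sgn_comp_mem_posType χ))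

lemma exp_sum_mem_posType {s : Finset ι} {c : ι → ℝ} (hc : ∀ i ∈ s, 0 ≤ c i) (χ : ι → X →* ℤˣ) :
    (fun σ => Real.exp (∑ i ∈ s, c i * sgn (χ i σ))) ∈ posType X := by
  simp_rw [Real.exp_sum]
  exact prod_mem_posType fun i hi => exp_mul_sgn_mem_posType (hc i hi) (χ i)

lemma prod_sub_prod_mem_posType (s : Finset ι) {f g : ι → X → ℝ}
    (hf : ∀ i ∈ s, f i ∈ posType X) (hg : ∀ i ∈ s, g i ∈ posType X)
    (hfg : ∀ i ∈ s, (fun σ => f i σ - g i σ) ∈ posType X) :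
    (fun σ => ∏ i ∈ s, f i σ - ∏ i ∈ s, g i σ) ∈ posType X := by
  classical
  induction s using Finset.induction_on with
  | empty => simpa using const_mem_posType (X := X) le_rfl
  | insert a s ha ih =>
    simp only [Finset.mem_insert, forall_eq_or_imp] at hf hg hfg
    have hleft := mul_mem_posType hf.1 (ih hf.2 hg.2 hfg.2)
    have hright := mul_mem_posType hfg.1 (prod_mem_posType hg.2)
    convert add_mem_posType hleft hright using 1
    ext σ
    rw [Finset.prod_insert ha, Finset.prod_insert ha]
    ring

lemma exp_sum_sub_mul_prod_mem_posType (s : Finset ι) {c : ℝ} (hc : 0 ≤ c) (χ : ι → X →* ℤˣ) :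
    (fun σ => Real.exp (∑ i ∈ s, c * sgn (χ i σ)) -
      Real.tanh c ^ s.card * (∏ i ∈ s, sgn (χ i σ)) * Real.exp (∑ i ∈ s, c * sgn (χ i σ))) ∈
      posType X := by
  have htanh : 0 ≤ Real.tanh c := by
    rw [Real.tanh_eq_sinh_div_cosh]
    exact div_nonneg (Real.sinh_nonneg_iff.2 hc) (Real.cosh_pos c).le
  have hexp := fun i => exp_mul_sgn_mem_posType hc (χ i)
  have hdiff := prod_sub_prod_mem_posType s (fun i _ => hexp i)
    (fun i _ => const_mul_mem_posType htanh (mul_mem_posType (sgn_comp_mem_posType (χ i)) (hexp i)))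
    fun i _ => by
      simp_rw [exp_mul_sgn_sub_tanh_mul]
      exact const_mem_posType (one_div_pos.2 (Real.cosh_pos c)).le
  simpa only [Finset.prod_mul_distrib, Finset.prod_const, ← Real.exp_sum, mul_assoc] using hdiff

lemma exp_sum_mul_one_add_mem_posType (s : Finset ι) {c u : ℝ} (hc : 0 < c)
    (hu : |u| ≤ Real.tanh c ^ s.card) (χ : ι → X →* ℤˣ) :
    (fun σ => Real.exp (∑ i ∈ s, c * sgn (χ i σ)) * (1 + u * ∏ i ∈ s, sgn (χ i σ))) ∈
      posType X := by
  have hexp := exp_sum_mem_posType (s := s) (c := fun _ => c) (fun _ _ => hc.le) χ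
  rcases le_or_gt 0 u with hu0 | hu0
  · exact mul_mem_posType hexp (add_mem_posType (const_mem_posType zero_le_one)
      (const_mul_mem_posType hu0 (prod_mem_posType fun i _ => sgn_comp_mem_posType (χ i))))
  set θ := Real.tanh c ^ s.card
  have hθ : 0 < θ := (neg_pos.2 hu0).trans_le ((abs_of_neg hu0).symm.trans_le hu)
  have hr : -u / θ ≤ 1 := by rwa [div_le_one hθ, ← abs_of_neg hu0]
  convert add_mem_posType (const_mul_mem_posType (sub_nonneg.2 hr) hexp)
    (const_mul_mem_posType (div_nonneg (neg_nonneg.2 hu0.le) hθ.le)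
      (exp_sum_sub_mul_prod_mem_posType s hc.le χ)) using 1
  ext σ
  field_simp
  ring

/-- The disjoint perturbations are absorbed one by one, each by a part `c` of the couplings on its
own index set. -/
lemma exp_sum_mul_prod_mem_posType {T : Type*} {t : Finset T} {s : Finset ι} {κ : ι → ℝ}
    (hκ : ∀ i ∈ s, 0 ≤ κ i) {S : T → Finset ι} (hS : ∀ y ∈ t, S y ⊆ s)
    (hd : (t : Set T).PairwiseDisjoint S) {c : ℝ} (hc : 0 < c) (hcκ : ∀ y ∈ t, ∀ i ∈ S y, c ≤ κ i)
    {u : T → ℝ} (hu : ∀ y ∈ t, |u y| ≤ Real.tanh c ^ (S y).card) (χ : ι → X →* ℤˣ) :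
    (fun σ => Real.exp (∑ i ∈ s, κ i * sgn (χ i σ)) *
      ∏ y ∈ t, (1 + u y * ∏ i ∈ S y, sgn (χ i σ))) ∈ posType X := by
  classical
  set U := t.biUnion S with hU
  have hUs : U ⊆ s := Finset.biUnion_subset.2 hS
  have hκU : ∀ i ∈ s, 0 ≤ κ i - if i ∈ U then c else 0 := fun i hi => by
    by_cases h : i ∈ U
    · obtain ⟨y, hy, hiy⟩ := Finset.mem_biUnion.1 h
      simpa [h] using hcκ y hy i hiy
    · simpa [h] using hκ i hi
  convert mul_mem_posType (exp_sum_mem_posType hκU χ) (prod_mem_posType fun y hy =>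
    exp_sum_mul_one_add_mem_posType (S y) hc (hu y hy) χ) using 1
  ext σ
  rw [Finset.prod_mul_distrib, ← Real.exp_sum, ← Finset.sum_biUnion hd, ← mul_assoc,
    ← Real.exp_add]
  congr 2
  rw [← hU, ← Finset.inter_eq_right.2 hUs, ← Finset.filter_mem_eq_inter, Finset.sum_filter,
    ← Finset.sum_add_distrib]
  refine Finset.sum_congr rfl fun i hi => ?_
  by_cases h : i ∈ U <;> simp [h, hi]
  ring

lemma exp_sum_mul_exp_sum_mem_posType {s : Finset ι} {κ κ' : ι → ℝ} (h : ∀ i ∈ s, |κ' i| ≤ κ i)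
    (χ : ι → X →* ℤˣ) (ρ : X) :
    (fun σ => Real.exp (∑ i ∈ s, κ i * sgn (χ i σ)) *
      Real.exp (∑ i ∈ s, κ' i * sgn (χ i (σ * ρ)))) ∈ posType X := by
  convert exp_sum_mem_posType (s := s) (c := fun i => κ i + κ' i * sgn (χ i ρ)) (fun i hi => ?_) χ
    using 1
  · ext σ
    rw [← Real.exp_add, ← Finset.sum_add_distrib]
    refine congrArg _ (Finset.sum_congr rfl fun i _ => ?_)
    rw [map_mul, map_mul]
    ring
  · have habs : |κ' i * sgn (χ i ρ)| ≤ κ i := by rw [abs_mul, abs_sgn, mul_one]; exact h i hi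
    linarith [neg_le_of_abs_le habs]

variable {C : Finset X}

lemma sum_mul_left_of_mul_mem (hC : ∀ a ∈ C, ∀ b ∈ C, a * b ∈ C) {a : X} (ha : a ∈ C)
    (f : X → ℝ) : ∑ σ ∈ C, f (a * σ) = ∑ σ ∈ C, f σ :=
  Finset.sum_nbij (a * ·) (hC a ha) (mul_right_injective a).injOn
    (Finset.surjOn_of_injOn_of_card_le _ (hC a ha) (mul_right_injective a).injOn le_rfl)
    fun _ _ => rfl

lemma sum_sgn_eq_zero (hC : ∀ a ∈ C, ∀ b ∈ C, a * b ∈ C) (χ : X →* ℤˣ) {a : X} (ha : a ∈ C)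
    (h : χ a = -1) : ∑ σ ∈ C, sgn (χ σ) = 0 := by
  have hsum := sum_mul_left_of_mul_mem hC ha fun σ => sgn (χ σ)
  simp_rw [map_mul, h, sgn_neg_one, neg_one_mul, Finset.sum_neg_distrib] at hsum
  linarith

lemma sum_sgn_nonneg (hC : ∀ a ∈ C, ∀ b ∈ C, a * b ∈ C) (χ : X →* ℤˣ) :
    0 ≤ ∑ σ ∈ C, sgn (χ σ) := by
  by_cases h : ∃ a ∈ C, χ a = -1
  · obtain ⟨a, ha, h⟩ := h
    exact (sum_sgn_eq_zero hC χ ha h).ge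
  · push Not at h
    refine Finset.sum_nonneg fun σ hσ => ?_
    rw [(Int.units_eq_one_or (χ σ)).resolve_right (h σ hσ), map_one]
    exact zero_le_one

lemma posType_eq_span : Subalgebra.toSubmodule (posType X) =
    Submodule.span NNReal (Set.range fun (χ : X →* ℤˣ) (σ : X) => sgn (χ σ)) := by
  let Φ : (X →* ℤˣ) →* (X → ℝ) :=
    { toFun := fun χ σ => sgn (χ σ)
      map_one' := by ext; simp
      map_mul' := fun χ ψ => by ext; simp }
  have hclosure : (Submonoid.closure (Set.range Φ) : Set (X → ℝ)) = Set.range Φ := by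
    rw [← MonoidHom.coe_mrange, Submonoid.closure_eq]
  rw [posType, Algebra.adjoin_eq_span]
  exact congrArg _ hclosure

lemma sum_nonneg_of_mem_posType (hC : ∀ a ∈ C, ∀ b ∈ C, a * b ∈ C) {f : X → ℝ}
    (hf : f ∈ posType X) : 0 ≤ ∑ σ ∈ C, f σ := by
  rw [← Subalgebra.mem_toSubmodule, posType_eq_span] at hf
  induction hf using Submodule.span_induction with
  | mem f hf =>
    obtain ⟨χ, rfl⟩ := hf
    exact sum_sgn_nonneg hC χ
  | zero => simp
  | add f g _ _ hf hg =>
    simp only [Pi.add_apply, Finset.sum_add_distrib]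
    exact add_nonneg hf hg
  | smul c f _ hf =>
    simp only [Pi.smul_apply, ← Finset.smul_sum]
    exact smul_nonneg c.2 hf

/-- Ginibre's duplication: the second configuration of a pair is written as the first one times a
relative configuration `ρ`, which is then frozen. -/
lemma sum_sgn_mul_mul_sum_le (hC : ∀ a ∈ C, ∀ b ∈ C, a * b ∈ C) {w w' : X → ℝ}
    (hw : ∀ ρ ∈ C, (fun σ => w σ * w' (σ * ρ)) ∈ posType X) (χ : X →* ℤˣ) :
    (∑ σ ∈ C, sgn (χ σ) * w' σ) * ∑ σ ∈ C, w σ ≤ (∑ σ ∈ C, sgn (χ σ) * w σ) * ∑ σ ∈ C, w' σ := by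
  have hfrozen : 0 ≤ ∑ ρ ∈ C, ∑ σ ∈ C, (1 - sgn (χ ρ)) * (sgn (χ σ) * (w σ * w' (σ * ρ))) :=
    Finset.sum_nonneg fun ρ hρ => sum_nonneg_of_mem_posType hC <|
      const_mul_mem_posType (sub_nonneg.2 (sgn_le_one _))
        (mul_mem_posType (sgn_comp_mem_posType χ) (hw ρ hρ))
  have hpair : ∑ ρ ∈ C, ∑ σ ∈ C, (1 - sgn (χ ρ)) * (sgn (χ σ) * (w σ * w' (σ * ρ))) =
      ∑ σ ∈ C, ∑ σ' ∈ C, (sgn (χ σ) - sgn (χ σ')) * (w σ * w' σ') := by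
    rw [Finset.sum_comm]
    refine Finset.sum_congr rfl fun σ hσ => ?_
    rw [← sum_mul_left_of_mul_mem hC hσ fun σ' => (sgn (χ σ) - sgn (χ σ')) * (w σ * w' σ')]
    refine Finset.sum_congr rfl fun ρ _ => ?_
    rw [map_mul, map_mul]
    ring
  have hsplit : ∑ σ ∈ C, ∑ σ' ∈ C, (sgn (χ σ) - sgn (χ σ')) * (w σ * w' σ') =
      (∑ σ ∈ C, sgn (χ σ) * w σ) * ∑ σ ∈ C, w' σ -
        (∑ σ ∈ C, sgn (χ σ) * w' σ) * ∑ σ ∈ C, w σ := by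
    rw [mul_comm (∑ σ ∈ C, sgn (χ σ) * w' σ), Finset.sum_mul_sum, Finset.sum_mul_sum,
      ← Finset.sum_sub_distrib]
    refine Finset.sum_congr rfl fun σ _ => ?_
    rw [← Finset.sum_sub_distrib]
    exact Finset.sum_congr rfl fun σ' _ => by ring
  rw [hpair, hsplit] at hfrozen
  exact sub_nonneg.1 hfrozen

end PosType

section Mean

variable {X ι : Type*} {C : Finset X}

/-- The mean of `f` on the finite set `C` with weight `w`; it is `0` if the total weight is. -/
def mean (C : Finset X) (w f : X → ℝ) : ℝ := (∑ σ ∈ C, f σ * w σ) / ∑ σ ∈ C, w σ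

lemma mean_add (w f g : X → ℝ) : mean C w (fun σ => f σ + g σ) = mean C w f + mean C w g := by
  simp only [mean, add_mul, Finset.sum_add_distrib, add_div]

lemma mean_const_mul (w : X → ℝ) (c : ℝ) (f : X → ℝ) :
    mean C w (fun σ => c * f σ) = c * mean C w f := by
  simp only [mean, mul_assoc, ← Finset.mul_sum, mul_div_assoc]

lemma mean_sum (s : Finset ι) (w : X → ℝ) (f : ι → X → ℝ) :
    mean C w (fun σ => ∑ i ∈ s, f i σ) = ∑ i ∈ s, mean C w (f i) := by
  simp only [mean, Finset.sum_mul, ← Finset.sum_div]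
  rw [Finset.sum_comm]

lemma mean_const {w : X → ℝ} (h : 0 < ∑ σ ∈ C, w σ) (c : ℝ) : mean C w (fun _ => c) = c := by
  rw [mean, ← Finset.mul_sum, mul_div_cancel_right₀ _ h.ne']

lemma mean_mono {w f g : X → ℝ} (hw : ∀ σ ∈ C, 0 ≤ w σ) (h : ∀ σ ∈ C, f σ ≤ g σ) :
    mean C w f ≤ mean C w g :=
  div_le_div_of_nonneg_right
    (Finset.sum_le_sum fun σ hσ => mul_le_mul_of_nonneg_right (h σ hσ) (hw σ hσ))
    (Finset.sum_nonneg hw)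

lemma abs_mean_le {w f : X → ℝ} (hw : ∀ σ ∈ C, 0 ≤ w σ) (h : 0 < ∑ σ ∈ C, w σ) {c : ℝ}
    (hf : ∀ σ, |f σ| ≤ c) : |mean C w f| ≤ c := by
  rw [abs_le, ← mean_const h (-c)]
  nth_rw 2 [← mean_const h c]
  exact ⟨mean_mono hw fun σ _ => neg_le_of_abs_le (hf σ),
    mean_mono hw fun σ _ => le_of_abs_le (hf σ)⟩

lemma mean_mul (w f g : X → ℝ) (h : ∑ σ ∈ C, g σ * w σ ≠ 0) :
    mean C w (fun σ => g σ * f σ) = mean C w g * mean C (fun σ => g σ * w σ) f := by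
  simp only [mean]
  rw [mul_comm, div_mul_div_cancel₀ h]
  congr 1
  exact Finset.sum_congr rfl fun _ _ => by ring

lemma mean_sgn_le_mean_sgn [CommGroup X] (hC : ∀ a ∈ C, ∀ b ∈ C, a * b ∈ C) {w w' : X → ℝ}
    (h0 : 0 < ∑ σ ∈ C, w σ) (h0' : 0 < ∑ σ ∈ C, w' σ)
    (hw : ∀ ρ ∈ C, (fun σ => w σ * w' (σ * ρ)) ∈ posType X) (χ : X →* ℤˣ) :
    mean C w' (fun σ => sgn (χ σ)) ≤ mean C w fun σ => sgn (χ σ) := by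
  rw [mean, mean, div_le_div_iff₀ h0' h0]
  exact sum_sgn_mul_mul_sum_le hC hw χ

end Mean

/-! ### Spin configurations -/

section Spin

variable {V : Type}

lemma Edge.map_injective {W : Type} (f : V ↪ W) : Function.Injective (Edge.map f) := fun _ _ h =>
  Subtype.ext (Sym2.map.injective f.injective (congrArg Subtype.val h))

/-- The product of the spins at the ends of an edge, as a character. -/
def bond (e : Sym2 V) : (V → ℤˣ) →* ℤˣ :=
  Sym2.lift ⟨fun x y => Pi.evalMonoidHom (fun _ : V => ℤˣ) x * Pi.evalMonoidHom (fun _ => ℤˣ) y,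
    fun _ _ => mul_comm _ _⟩ e

@[simp] lemma bond_mk (x y : V) (σ : V → ℤˣ) : bond s(x, y) σ = σ x * σ y := rfl

lemma bond_map {W : Type} (f : V → W) (e : Sym2 V) (σ : W → ℤˣ) :
    bond (e.map f) σ = bond e (σ ∘ f) := by
  induction e using Sym2.ind with
  | _ x y => simp

lemma bond_congr {e : Sym2 V} {σ τ : V → ℤˣ} (h : ∀ x ∈ e, σ x = τ x) : bond e σ = bond e τ := by
  induction e using Sym2.ind with
  | _ x y => simp [h x, h y]

/-- The product of the edge spins over a finite set of edges. -/
def bondProd (S : Finset (Edge V)) (σ : V → ℤˣ) : ℝ := ∏ e ∈ S, sgn (bond e.1 σ)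

lemma bondProd_eq_sgn (S : Finset (Edge V)) :
    bondProd S = fun σ => sgn ((∏ e ∈ S, bond e.1 : (V → ℤˣ) →* ℤˣ) σ) := by
  ext σ
  rw [bondProd, MonoidHom.finsetProd_apply, map_prod]

@[simp] lemma abs_bondProd (S : Finset (Edge V)) (σ : V → ℤˣ) : |bondProd S σ| = 1 := by
  rw [bondProd_eq_sgn, abs_sgn]

lemma bondProd_mul (S : Finset (Edge V)) (σ τ : V → ℤˣ) :
    bondProd S (σ * τ) = bondProd S σ * bondProd S τ := by
  simp only [bondProd_eq_sgn, map_mul]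

open scoped Classical in
/-- The edges contained in a finite set of vertices. -/
def edgesIn (G : Finset V) : Finset (Edge V) :=
  Finset.univ.map ⟨Edge.map (Function.Embedding.subtype (· ∈ G)), Edge.map_injective _⟩

lemma mem_edgesIn {G : Finset V} {e : Edge V} : e ∈ edgesIn G ↔ ∀ x ∈ e.1, x ∈ G := by
  simp only [edgesIn, Finset.mem_map, Finset.mem_univ, true_and, Function.Embedding.coeFn_mk]
  constructor
  · rintro ⟨e, rfl⟩ x hx
    obtain ⟨y, -, rfl⟩ := Sym2.mem_map.1 hx
    exact y.2
  · intro h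
    obtain ⟨e, he⟩ := e
    induction e using Sym2.ind with
    | _ x y =>
      refine ⟨⟨s(⟨x, h x (by simp)⟩, ⟨y, h y (by simp)⟩), ?_⟩, ?_⟩
      · simpa [Subtype.ext_iff] using he
      · simp [Edge.map]

lemma edgesIn_mono {G G' : Finset V} (h : G ⊆ G') : edgesIn G ⊆ edgesIn G' :=
  fun _ he => mem_edgesIn.2 fun x hx => h (mem_edgesIn.1 he x hx)

lemma dependsOn_bondProd {G : Finset V} {S : Finset (Edge V)} (hS : S ⊆ edgesIn G) :
    DependsOn (bondProd S) (G : Set V) := fun _ _ h =>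
  Finset.prod_congr rfl fun _ he => congrArg sgn <| bond_congr fun x hx =>
    h x (mem_edgesIn.1 (hS he) x hx)

lemma sum_edgesIn_insert [DecidableEq V] {G : Finset V} {z : V} (hz : z ∉ G) (f : Sym2 V → ℝ) :
    ∑ e ∈ edgesIn (insert z G), f e.1 = ∑ e ∈ edgesIn G, f e.1 + ∑ x ∈ G, f s(z, x) := by
  rw [← Finset.sum_filter_add_sum_filter_not _ (fun e : Edge V => z ∉ e.1)]
  congr 1
  · refine Finset.sum_congr ?_ fun _ _ => rfl
    ext e
    simp only [Finset.mem_filter, mem_edgesIn, Finset.mem_insert]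
    constructor
    · rintro ⟨h, h'⟩ x hx
      exact (h x hx).resolve_left fun h'' => h' (h'' ▸ hx)
    · exact fun h => ⟨fun x hx => Or.inr (h x hx), fun h' => hz (h z h')⟩
  · symm
    refine Finset.sum_bij (fun x hx => ⟨s(z, x), by
      simpa using fun h : z = x => hz (h ▸ hx)⟩) ?_ ?_ ?_ (fun _ _ => rfl)
    · intro x hx
      simp [mem_edgesIn, hx]
    · intro x hx y hy h
      simpa [show z ≠ y from fun h => hz (h ▸ hy)] using h
    · rintro ⟨e, he⟩ h
      simp only [Finset.mem_filter, mem_edgesIn, not_not] at h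
      obtain ⟨y, rfl⟩ := Sym2.mem_iff_exists.1 h.2
      have hy := h.1 y (by simp)
      have hzy : z ≠ y := by simpa using he
      exact ⟨y, (Finset.mem_insert.1 hy).resolve_left hzy.symm, rfl⟩

open scoped Classical in
/-- The spin configurations that are `1` outside a finite set. -/
def spinConfigs (G : Finset V) : Finset (V → ℤˣ) :=
  G.powerset.image fun S x => if x ∈ S then -1 else 1

lemma mem_spinConfigs {G : Finset V} {σ : V → ℤˣ} : σ ∈ spinConfigs G ↔ ∀ x ∉ G, σ x = 1 := by
  classical
  simp only [spinConfigs, Finset.mem_image, Finset.mem_powerset]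
  constructor
  · rintro ⟨S, hS, rfl⟩ x hx
    exact if_neg fun h => hx (hS h)
  · intro h
    refine ⟨G.filter fun x => σ x = -1, Finset.filter_subset _ _, ?_⟩
    ext x
    by_cases hx : x ∈ G
    · rcases Int.units_eq_one_or (σ x) with h1 | h1 <;> simp [hx, h1]
    · simp [hx, h x hx]

lemma mul_mem_spinConfigs {G : Finset V} :
    ∀ σ ∈ spinConfigs G, ∀ τ ∈ spinConfigs G, σ * τ ∈ spinConfigs G := by
  intro σ hσ τ hτ
  rw [mem_spinConfigs] at *
  intro x hx
  rw [Pi.mul_apply, hσ x hx, hτ x hx, one_mul]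

lemma one_mem_spinConfigs (G : Finset V) : (1 : V → ℤˣ) ∈ spinConfigs G :=
  mem_spinConfigs.2 fun _ _ => rfl

variable [DecidableEq V] {G G' : Finset V} {z : V}

lemma mulSingle_mem_spinConfigs (hz : z ∈ G) (u : ℤˣ) : Pi.mulSingle z u ∈ spinConfigs G :=
  mem_spinConfigs.2 fun x hx => Pi.mulSingle_eq_of_ne (by rintro rfl; exact hx hz) _

lemma sum_spinConfigs_eq_sum_insert (hz : z ∉ G) (F : (V → ℤˣ) → ℝ) :
    ∑ σ ∈ spinConfigs G, F σ = ∑ σ ∈ spinConfigs (insert z G), (1 + sgn (σ z)) / 2 * F σ := by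
  have hfilter : spinConfigs G = (spinConfigs (insert z G)).filter fun σ => σ z = 1 := by
    ext σ
    simp only [Finset.mem_filter, mem_spinConfigs, Finset.mem_insert]
    constructor
    · exact fun h => ⟨fun x hx => h x fun h' => hx (Or.inr h'), h z hz⟩
    · rintro ⟨h, h'⟩ x hx
      by_cases hxz : x = z
      · rw [hxz, h']
      · exact h x (by tauto)
  rw [hfilter, Finset.sum_filter]
  refine Finset.sum_congr rfl fun σ _ => ?_
  rcases Int.units_eq_one_or (σ z) with h | h
  · simp [h]
  · simp [h, show (-1 : ℤˣ) ≠ 1 by decide]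

lemma sum_spinConfigs_insert (hz : z ∉ G) {F : (V → ℤˣ) → ℝ} (hF : DependsOn F ({z}ᶜ : Set V)) :
    ∑ σ ∈ spinConfigs (insert z G), F σ = 2 * ∑ σ ∈ spinConfigs G, F σ := by
  have hflip := sum_mul_left_of_mul_mem (mul_mem_spinConfigs (G := insert z G))
    (mulSingle_mem_spinConfigs (Finset.mem_insert_self z G) (-1)) fun σ => sgn (σ z) * F σ
  have hF' : ∀ σ, F (Pi.mulSingle z (-1) * σ) = F σ := fun σ => hF fun x hx => by
    rw [Pi.mul_apply, Pi.mulSingle_eq_of_ne hx, one_mul]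
  simp_rw [Pi.mul_apply, map_mul, hF', Pi.mulSingle_eq_same, sgn_neg_one, neg_one_mul, neg_mul,
    Finset.sum_neg_distrib] at hflip
  rw [sum_spinConfigs_eq_sum_insert hz]
  simp_rw [div_mul_eq_mul_div, add_mul, one_mul, ← Finset.sum_div, Finset.sum_add_distrib]
  linarith

lemma sum_spinConfigs_of_subset (hG : G ⊆ G') {F : (V → ℤˣ) → ℝ} (hF : DependsOn F (G : Set V)) :
    ∑ σ ∈ spinConfigs G', F σ = 2 ^ (G' \ G).card * ∑ σ ∈ spinConfigs G, F σ := by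
  have hunion : ∀ D : Finset V, Disjoint D G →
      ∑ σ ∈ spinConfigs (D ∪ G), F σ = 2 ^ D.card * ∑ σ ∈ spinConfigs G, F σ := by
    intro D
    induction D using Finset.induction_on with
    | empty => simp
    | insert a s ha ih =>
      intro hD
      rw [Finset.disjoint_insert_left] at hD
      have hFa : DependsOn F ({a}ᶜ : Set V) := fun σ τ h =>
        hF fun x hx => h x fun hxa : x = a => hD.1 (hxa ▸ hx)
      rw [Finset.insert_union, sum_spinConfigs_insert (by simp [ha, hD.1]) hFa, ih hD.2,
        Finset.card_insert_of_notMem ha]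
      ring
  rw [← hunion _ Finset.sdiff_disjoint, Finset.sdiff_union_of_subset hG]

end Spin

/-! ### The Ising model -/

section Ising

variable {V : Type}

/-- The Ising weight with couplings `β J` and magnetic field `β h` on `G`. -/
def isingWeight (J : Sym2 V → ℝ) (β : ℝ) (h : V → ℝ) (G : Finset V) (σ : V → ℤˣ) : ℝ :=
  Real.exp (∑ e ∈ edgesIn G, β * J e.1 * sgn (bond e.1 σ) + ∑ x ∈ G, β * h x * sgn (σ x))

/-- The mean value of `f` in the Ising model on `G` with couplings `β J` and magnetic
field `β h`. -/
def isingMean (J : Sym2 V → ℝ) (β : ℝ) (h : V → ℝ) (G : Finset V) (f : (V → ℤˣ) → ℝ) : ℝ :=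
  mean (spinConfigs G) (isingWeight J β h G) f

variable {J : Sym2 V → ℝ} {β β' : ℝ} {h : V → ℝ} {G G' : Finset V}

lemma isingWeight_pos (σ : V → ℤˣ) : 0 < isingWeight J β h G σ := Real.exp_pos _

lemma sum_isingWeight_pos (G' : Finset V) : 0 < ∑ σ ∈ spinConfigs G', isingWeight J β h G σ :=
  Finset.sum_pos (fun σ _ => isingWeight_pos σ) ⟨1, one_mem_spinConfigs G'⟩

lemma isingMean_const (c : ℝ) : isingMean J β h G (fun _ => c) = c :=
  mean_const (sum_isingWeight_pos G) c

lemma isingMean_mono {f g : (V → ℤˣ) → ℝ} (hfg : ∀ σ, f σ ≤ g σ) :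
    isingMean J β h G f ≤ isingMean J β h G g :=
  mean_mono (fun σ _ => (isingWeight_pos σ).le) fun σ _ => hfg σ

lemma abs_isingMean_le {f : (V → ℤˣ) → ℝ} {c : ℝ} (hf : ∀ σ, |f σ| ≤ c) :
    |isingMean J β h G f| ≤ c :=
  abs_mean_le (fun σ _ => (isingWeight_pos σ).le) (sum_isingWeight_pos G) hf

lemma continuous_isingMean (f : (V → ℤˣ) → ℝ) : Continuous fun β => isingMean J β h G f := by
  unfold isingMean mean isingWeight
  exact Continuous.div (by fun_prop) (by fun_prop) fun β => (sum_isingWeight_pos G).ne'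

lemma isingWeight_zero_field (J : Sym2 V → ℝ) (β : ℝ) (G : Finset V) (σ : V → ℤˣ) :
    isingWeight J β 0 G σ = Real.exp (∑ e ∈ edgesIn G, β * J e.1 * sgn (bond e.1 σ)) := by
  simp only [isingWeight, Pi.zero_apply, mul_zero, zero_mul, Finset.sum_const_zero, add_zero]

lemma dependsOn_isingWeight : DependsOn (isingWeight J β h G) (G : Set V) := by
  intro σ τ hστ
  rw [isingWeight, isingWeight]
  congr 2
  · exact Finset.sum_congr rfl fun e he => by
      rw [bond_congr fun x hx => hστ x (mem_edgesIn.1 he x hx)]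
  · exact Finset.sum_congr rfl fun x hx => by rw [hστ x hx]

lemma isingMean_eq_mean_of_subset (hG : G ⊆ G') {f : (V → ℤˣ) → ℝ}
    (hf : DependsOn f (G : Set V)) :
    isingMean J β h G f = mean (spinConfigs G') (isingWeight J β h G) f := by
  classical
  have hfw : DependsOn (fun σ => f σ * isingWeight J β h G σ) (G : Set V) := fun σ τ hστ =>
    congrArg₂ (· * ·) (hf hστ) (dependsOn_isingWeight hστ)
  rw [isingMean, mean, mean, sum_spinConfigs_of_subset hG hfw,
    sum_spinConfigs_of_subset hG dependsOn_isingWeight, mul_div_mul_left _ _ (by positivity)]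

lemma isingWeight_mul_isingWeight (J : Sym2 V → ℝ) (β β' : ℝ) (h : V → ℝ) (G : Finset V)
    (σ ρ : V → ℤˣ) :
    isingWeight J β h G σ * isingWeight J β' h G (σ * ρ) =
      Real.exp (∑ e ∈ edgesIn G, (β + β' * sgn (bond e.1 ρ)) * J e.1 * sgn (bond e.1 σ)) *
        Real.exp (∑ x ∈ G, (β + β' * sgn (ρ x)) * h x *
          sgn (Pi.evalMonoidHom (fun _ : V => ℤˣ) x σ)) := by
  rw [isingWeight, isingWeight, ← Real.exp_add, ← Real.exp_add]
  congr 1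
  simp only [map_mul, Pi.mul_apply, Pi.evalMonoidHom_apply]
  rw [add_add_add_comm, ← Finset.sum_add_distrib, ← Finset.sum_add_distrib]
  congr 1 <;> exact Finset.sum_congr rfl fun _ _ => by ring

lemma isingWeight_mul_prod_mem_posType (hJ : ∀ e, 0 ≤ J e) (hh : ∀ x ∈ G, 0 ≤ h x)
    (hβ' : 0 ≤ β') (hβ : β' ≤ β) {T : Type*} {t : Finset T} {S : T → Finset (Edge V)}
    (hS : ∀ y ∈ t, S y ⊆ edgesIn G) (hd : (t : Set T).PairwiseDisjoint S) {c : ℝ} (hc : 0 < c)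
    (hcJ : ∀ y ∈ t, ∀ e ∈ S y, c ≤ (β - β') * J e.1) {u : T → ℝ}
    (hu : ∀ y ∈ t, |u y| ≤ Real.tanh c ^ (S y).card) (ρ : V → ℤˣ) :
    (fun σ => isingWeight J β h G σ * isingWeight J β' h G (σ * ρ) *
      ∏ y ∈ t, (1 + u y * bondProd (S y) σ)) ∈ posType (V → ℤˣ) := by
  have hle : ∀ v : ℤˣ, β - β' ≤ β + β' * sgn v := fun v => by
    nlinarith [neg_le_of_abs_le (abs_sgn v).le]
  have hnonneg : ∀ v : ℤˣ, 0 ≤ β + β' * sgn v := fun v => (sub_nonneg.2 hβ).trans (hle v)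
  have hedges := exp_sum_mul_prod_mem_posType (s := edgesIn G)
    (κ := fun e => (β + β' * sgn (bond e.1 ρ)) * J e.1) (fun e _ => mul_nonneg (hnonneg _) (hJ _))
    hS hd hc (fun y hy e he => (hcJ y hy e he).trans
      (mul_le_mul_of_nonneg_right (hle _) (hJ _))) hu fun e => bond e.1
  have hsites := exp_sum_mem_posType (s := G) (c := fun x => (β + β' * sgn (ρ x)) * h x)
    (fun x hx => mul_nonneg (hnonneg _) (hh x hx)) fun x => Pi.evalMonoidHom (fun _ : V => ℤˣ) x
  convert mul_mem_posType hedges hsites using 1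
  ext σ
  rw [isingWeight_mul_isingWeight, mul_right_comm]
  rfl

lemma isingWeight_mul_mem_posType (hJ : ∀ e, 0 ≤ J e) (hh : ∀ x ∈ G, 0 ≤ h x)
    (hβ : 0 ≤ β) (ρ : V → ℤˣ) :
    (fun σ => isingWeight J β h G σ * isingWeight J β h G (σ * ρ)) ∈ posType (V → ℤˣ) := by
  simpa using isingWeight_mul_prod_mem_posType (t := (∅ : Finset Unit)) (S := fun _ => ∅) hJ hh hβ
    le_rfl (by simp) (by simp) one_pos (by simp) (u := fun _ => 0) (by simp) ρ

/-! ### Dependence on the volume -/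

lemma isingMean_free_mono (hJ : ∀ e, 0 ≤ J e) (hβ : 0 ≤ β) (hG : G ⊆ G')
    {S : Finset (Edge V)} (hS : S ⊆ edgesIn G) :
    isingMean J β 0 G (bondProd S) ≤ isingMean J β 0 G' (bondProd S) := by
  classical
  rw [isingMean_eq_mean_of_subset hG (dependsOn_bondProd hS), bondProd_eq_sgn]
  refine mean_sgn_le_mean_sgn mul_mem_spinConfigs (sum_isingWeight_pos _)
    (sum_isingWeight_pos _) (fun ρ _ => ?_) _
  have hweight : ∀ σ, isingWeight J β 0 G σ = Real.exp (∑ e ∈ edgesIn G',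
      (if e ∈ edgesIn G then β * J e.1 else 0) * sgn (bond e.1 σ)) := fun σ => by
    simp_rw [ite_mul, zero_mul]
    rw [isingWeight_zero_field, ← Finset.sum_filter, Finset.filter_mem_eq_inter,
      Finset.inter_eq_right.2 (edgesIn_mono hG)]
  simp_rw [hweight, isingWeight_zero_field]
  refine exp_sum_mul_exp_sum_mem_posType (κ := fun e : Edge V => β * J e.1)
    (κ' := fun e => if e ∈ edgesIn G then β * J e.1 else 0) (fun e _ => ?_) (fun e => bond e.1) ρ
  have hnonneg : 0 ≤ β * J e.1 := mul_nonneg hβ (hJ _)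
  split_ifs
  · rw [abs_of_nonneg hnonneg]
  · rwa [abs_zero]

section Insert

variable [DecidableEq V] {z : V} {h' : V → ℝ}

lemma one_add_sgn_mul_isingWeight (hz : z ∉ G) (hh : ∀ x ∈ G, h x = h' x + J s(z, x))
    (σ : V → ℤˣ) :
    (1 + sgn (σ z)) / 2 * isingWeight J β h G σ =
      Real.exp (-(β * h' z)) * ((1 + sgn (σ z)) / 2 * isingWeight J β h' (insert z G) σ) := by
  rcases sgn_eq_one_or (σ z) with hσ | hσ
  · have hfield : ∑ x ∈ G, β * h x * sgn (σ x) =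
        ∑ x ∈ G, β * J s(z, x) * sgn (bond s(z, x) σ) + ∑ x ∈ G, β * h' x * sgn (σ x) := by
      rw [← Finset.sum_add_distrib]
      refine Finset.sum_congr rfl fun x hx => ?_
      rw [hh x hx, bond_mk, map_mul, hσ]
      ring
    rw [isingWeight, isingWeight, sum_edgesIn_insert hz fun e => β * J e * sgn (bond e σ), hfield,
      Finset.sum_insert hz, hσ, mul_left_comm, ← Real.exp_add]
    congr 2
    ring
  · simp [hσ]

lemma isingMean_eq_mean_insert (hz : z ∉ G) (hh : ∀ x ∈ G, h x = h' x + J s(z, x))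
    (f : (V → ℤˣ) → ℝ) :
    isingMean J β h G f = mean (spinConfigs (insert z G))
      (fun σ => (1 + sgn (σ z)) / 2 * isingWeight J β h' (insert z G) σ) f := by
  rw [isingMean, mean, mean, sum_spinConfigs_eq_sum_insert hz, sum_spinConfigs_eq_sum_insert hz]
  simp_rw [mul_left_comm _ (f _), one_add_sgn_mul_isingWeight hz hh,
    mul_left_comm (f _) (Real.exp _)]
  rw [← Finset.mul_sum, ← Finset.mul_sum, mul_div_mul_left _ _ (Real.exp_pos _).ne']

/-- A vertex with spin fixed to `1` acts on the other vertices as a magnetic field; here it is set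
free. -/
lemma isingMean_insert_le (hJ : ∀ e, 0 ≤ J e) (hβ : 0 ≤ β) (hz : z ∉ G)
    (hh' : ∀ x ∈ insert z G, 0 ≤ h' x) (hh : ∀ x ∈ G, h x = h' x + J s(z, x))
    (S : Finset (Edge V)) :
    isingMean J β h' (insert z G) (bondProd S) ≤ isingMean J β h G (bondProd S) := by
  have hplus : (fun σ : V → ℤˣ => (1 + sgn (σ z)) / 2) ∈ posType (V → ℤˣ) := by
    simp_rw [div_eq_inv_mul]
    exact const_mul_mem_posType (by norm_num) (add_mem_posType (const_mem_posType zero_le_one)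
      (sgn_comp_mem_posType (Pi.evalMonoidHom (fun _ : V => ℤˣ) z)))
  rw [isingMean_eq_mean_insert hz hh, bondProd_eq_sgn]
  refine mean_sgn_le_mean_sgn mul_mem_spinConfigs ?_ (sum_isingWeight_pos _) (fun ρ _ => ?_) _
  · refine Finset.sum_pos' (fun σ _ => mul_nonneg ?_ (isingWeight_pos σ).le)
      ⟨1, one_mem_spinConfigs _, mul_pos (by simp) (isingWeight_pos _)⟩
    linarith [neg_le_of_abs_le (abs_sgn (σ z)).le]
  · simp_rw [mul_assoc]
    exact mul_mem_posType hplus (isingWeight_mul_mem_posType hJ hh' hβ ρ)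

end Insert

/-! ### Tilted means -/

section Tilt

variable {T : Type*} {t : Finset T} {S : T → Finset (Edge V)} {a c : ℝ}

/-- The perturbation `∏ (1 + a σ_{S y})` of an Ising weight by products of edge spins. -/
def tilt (a : ℝ) (S : T → Finset (Edge V)) (t : Finset T) (σ : V → ℤˣ) : ℝ :=
  ∏ y ∈ t, (1 + a * bondProd (S y) σ)

lemma tilt_pos (ha : |a| < 1) (σ : V → ℤˣ) : 0 < tilt a S t σ := Finset.prod_pos fun y _ => by
  have habs : |a * bondProd (S y) σ| < 1 := by rwa [abs_mul, abs_bondProd, mul_one]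
  linarith [neg_lt_of_abs_lt habs]

lemma tilt_mul_isingWeight_pos (ha : |a| < 1) (σ : V → ℤˣ) :
    0 < tilt a S t σ * isingWeight J β h G σ := mul_pos (tilt_pos ha σ) (isingWeight_pos σ)

lemma sum_tilt_mul_isingWeight_pos (ha : |a| < 1) :
    0 < ∑ σ ∈ spinConfigs G, tilt a S t σ * isingWeight J β h G σ :=
  Finset.sum_pos (fun σ _ => tilt_mul_isingWeight_pos ha σ) ⟨1, one_mem_spinConfigs G⟩

lemma isingMean_le_mean_tilt (hJ : ∀ e, 0 ≤ J e) (hh : ∀ x ∈ G, 0 ≤ h x)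
    (hβ' : 0 ≤ β') (hβ : β' ≤ β) (hS : ∀ y ∈ t, S y ⊆ edgesIn G)
    (hd : (t : Set T).PairwiseDisjoint S) (hc : 0 < c)
    (hcJ : ∀ y ∈ t, ∀ e ∈ S y, c ≤ (β - β') * J e.1) (ha : |a| < 1)
    (hac : ∀ y ∈ t, |a| ≤ Real.tanh c ^ (S y).card) (R : Finset (Edge V)) :
    isingMean J β' h G (bondProd R) ≤
      mean (spinConfigs G) (fun σ => tilt a S t σ * isingWeight J β h G σ) (bondProd R) := by
  rw [bondProd_eq_sgn]
  refine mean_sgn_le_mean_sgn mul_mem_spinConfigs (sum_tilt_mul_isingWeight_pos ha)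
    (sum_isingWeight_pos _) (fun ρ _ => ?_) _
  convert isingWeight_mul_prod_mem_posType hJ hh hβ' hβ hS hd hc hcJ hac ρ using 1
  ext σ
  rw [tilt]
  ring

lemma mean_tilt_le_isingMean (hJ : ∀ e, 0 ≤ J e) (hh : ∀ x ∈ G, 0 ≤ h x)
    (hβ' : 0 ≤ β') (hβ : β' ≤ β) (hS : ∀ y ∈ t, S y ⊆ edgesIn G)
    (hd : (t : Set T).PairwiseDisjoint S) (hc : 0 < c)
    (hcJ : ∀ y ∈ t, ∀ e ∈ S y, c ≤ (β - β') * J e.1) (ha : |a| < 1)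
    (hac : ∀ y ∈ t, |a| ≤ Real.tanh c ^ (S y).card) (R : Finset (Edge V)) :
    mean (spinConfigs G) (fun σ => tilt a S t σ * isingWeight J β' h G σ) (bondProd R) ≤
      isingMean J β h G (bondProd R) := by
  rw [bondProd_eq_sgn]
  refine mean_sgn_le_mean_sgn mul_mem_spinConfigs (sum_isingWeight_pos _)
    (sum_tilt_mul_isingWeight_pos ha) (fun ρ _ => ?_) _
  convert isingWeight_mul_prod_mem_posType hJ hh hβ' hβ hS hd hc hcJ
    (u := fun y => a * bondProd (S y) ρ) (fun y hy => by simpa [abs_mul] using hac y hy) ρ using 1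
  ext σ
  have htilt : tilt a S t (σ * ρ) = ∏ y ∈ t, (1 + a * bondProd (S y) ρ * bondProd (S y) σ) :=
    Finset.prod_congr rfl fun y _ => by rw [bondProd_mul]; ring
  rw [htilt]
  ring

lemma sgn_mul_mean_tilt_le (s : ℤˣ) (hJ : ∀ e, 0 ≤ J e) (hh : ∀ x ∈ G, 0 ≤ h x)
    (hβ : 0 ≤ β) (hβ' : 0 ≤ β') (hs : 0 ≤ sgn s * (β' - β)) (hS : ∀ y ∈ t, S y ⊆ edgesIn G)
    (hd : (t : Set T).PairwiseDisjoint S) (hc : 0 < c)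
    (hcJ : ∀ y ∈ t, ∀ e ∈ S y, c ≤ sgn s * (β' - β) * J e.1) (ha : |a| < 1)
    (hac : ∀ y ∈ t, |a| ≤ Real.tanh c ^ (S y).card) (R : Finset (Edge V)) :
    sgn s *
      mean (spinConfigs G) (fun σ => tilt a S t σ * isingWeight J β h G σ) (bondProd R) ≤
      sgn s * isingMean J β' h G (bondProd R) := by
  rcases Int.units_eq_one_or s with rfl | rfl
  · simp only [map_one, one_mul] at hs hcJ ⊢
    exact mean_tilt_le_isingMean hJ hh hβ (sub_nonneg.1 hs) hS hd hc hcJ ha hac R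
  · simp only [sgn_neg_one, neg_one_mul, neg_sub, neg_le_neg_iff] at hs hcJ ⊢
    exact isingMean_le_mean_tilt hJ hh hβ' (sub_nonneg.1 hs) hS hd hc hcJ ha hac R

lemma isingMean_tilt_insert [DecidableEq T] {x : T} (hx : x ∉ t) (ha : |a| < 1) :
    isingMean J β h G (tilt a S (insert x t)) = isingMean J β h G (tilt a S t) *
      (1 + a * mean (spinConfigs G) (fun σ => tilt a S t σ * isingWeight J β h G σ)
        (bondProd (S x))) := by
  have hsum := sum_tilt_mul_isingWeight_pos (J := J) (β := β) (h := h) (G := G) (S := S) (t := t) ha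
  have htilt : tilt a S (insert x t) = fun σ => tilt a S t σ * (1 + a * bondProd (S x) σ) := by
    ext σ
    rw [tilt, Finset.prod_insert hx, mul_comm, tilt]
  rw [htilt, isingMean, mean_mul _ _ _ hsum.ne', mean_add, mean_const hsum, mean_const_mul,
    isingMean]

lemma isingMean_tilt_le {m : ℝ} (ha : |a| < 1) (hm : ∀ t' ⊆ t, ∀ x ∈ t, a * mean (spinConfigs G)
      (fun σ => tilt a S t' σ * isingWeight J β h G σ) (bondProd (S x)) ≤ m) :
    isingMean J β h G (tilt a S t) ≤ (1 + m) ^ t.card := by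
  classical
  induction t using Finset.induction_on with
  | empty =>
    have htilt : tilt a S ∅ = fun _ : V → ℤˣ => 1 := funext fun _ => Finset.prod_empty
    rw [htilt, isingMean_const, Finset.card_empty, pow_zero]
  | insert x t hx ih =>
    set M := mean (spinConfigs G) (fun σ => tilt a S t σ * isingWeight J β h G σ) (bondProd (S x))
    have hM : |M| ≤ 1 := abs_mean_le (fun σ _ => (tilt_mul_isingWeight_pos ha σ).le)
      (sum_tilt_mul_isingWeight_pos ha) fun σ => (abs_bondProd (S x) σ).le
    have haM : |a * M| ≤ 1 := by
      rw [abs_mul]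
      exact mul_le_one₀ ha.le (abs_nonneg _) hM
    have haMm : a * M ≤ m := hm t (Finset.subset_insert _ _) x (Finset.mem_insert_self _ _)
    have hfactor : 0 ≤ 1 + a * M := by linarith [neg_le_of_abs_le haM]
    rw [isingMean_tilt_insert hx ha, Finset.card_insert_of_notMem hx, pow_succ]
    exact mul_le_mul (ih fun t' ht' y hy => hm t' (ht'.trans (Finset.subset_insert _ _)) y
      (Finset.mem_insert_of_mem hy)) (by linarith) hfactor (pow_nonneg (by linarith) _)

end Tilt

end Ising

/-! ### Translations -/

section Translation

variable {d : ℕ}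

/-- The translate by `x` of a finite set of vertices. -/
def shiftSites (x : Site d) (G : Finset (Site d)) : Finset (Site d) :=
  G.map (Equiv.addRight x).toEmbedding

/-- The translate by `x` of a finite set of edges. -/
def shiftEdges (x : Site d) (S : Finset (Edge (Site d))) : Finset (Edge (Site d)) :=
  S.map ⟨Edge.map (Equiv.addRight x).toEmbedding, Edge.map_injective _⟩

lemma mem_shiftSites {x y : Site d} {G : Finset (Site d)} : y ∈ shiftSites x G ↔ y - x ∈ G := by
  simp only [shiftSites, Finset.mem_map, Equiv.coe_toEmbedding, Equiv.coe_addRight]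
  exact ⟨fun ⟨a, ha, h⟩ => by rwa [← h, add_sub_cancel_right], fun h => ⟨_, h, sub_add_cancel _ _⟩⟩

lemma shiftSites_shiftSites_neg (x : Site d) (G : Finset (Site d)) :
    shiftSites x (shiftSites (-x) G) = G := by
  ext y
  simp [mem_shiftSites]

lemma map_addRight_map_addRight_neg (x : Site d) (e : Edge (Site d)) :
    (e.map (Equiv.addRight (-x)).toEmbedding).map (Equiv.addRight x).toEmbedding = e := by
  have hcomp : (Equiv.addRight x).toEmbedding ∘ (Equiv.addRight (-x)).toEmbedding = id := by
    funext z
    simp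
  apply Subtype.ext
  change Sym2.map _ (Sym2.map _ e.1) = e.1
  rw [Sym2.map_map, hcomp, Sym2.map_id, id]

lemma shiftEdges_edgesIn (x : Site d) (G : Finset (Site d)) :
    shiftEdges x (edgesIn G) = edgesIn (shiftSites x G) := by
  ext e
  simp only [shiftEdges, Finset.mem_map, Function.Embedding.coeFn_mk, mem_edgesIn]
  constructor
  · rintro ⟨e, he, rfl⟩ y hy
    obtain ⟨z, hz, rfl⟩ := Sym2.mem_map.1 hy
    exact mem_shiftSites.2 (by simpa using he z hz)
  · refine fun h => ⟨_, fun y hy => ?_, map_addRight_map_addRight_neg x e⟩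
    obtain ⟨z, hz, rfl⟩ := Sym2.mem_map.1 hy
    simpa [sub_eq_add_neg] using mem_shiftSites.1 (h z hz)

lemma shiftEdges_mono (x : Site d) {S S' : Finset (Edge (Site d))} (h : S ⊆ S') :
    shiftEdges x S ⊆ shiftEdges x S' := Finset.map_subset_map.2 h

lemma bondProd_shiftEdges (x : Site d) (S : Finset (Edge (Site d))) :
    bondProd (shiftEdges x S) = fun σ => bondProd S (σ ∘ (· + x)) := by
  ext σ
  simp only [bondProd, shiftEdges, Finset.prod_map, Function.Embedding.coeFn_mk, Edge.map, bond_map]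
  rfl

lemma sum_spinConfigs_shiftSites (x : Site d) (G : Finset (Site d)) (F : (Site d → ℤˣ) → ℝ) :
    ∑ σ ∈ spinConfigs (shiftSites x G), F (σ ∘ (· + x)) = ∑ σ ∈ spinConfigs G, F σ := by
  refine Finset.sum_nbij' (· ∘ (· + x)) (· ∘ (· - x)) ?_ ?_ ?_ ?_ (fun _ _ => rfl)
  · intro σ hσ
    rw [mem_spinConfigs] at hσ ⊢
    exact fun y hy => hσ _ (by simpa [mem_shiftSites] using hy)
  · intro σ hσ
    rw [mem_spinConfigs] at hσ ⊢
    exact fun y hy => hσ _ (by simpa [mem_shiftSites] using hy)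
  · intro σ _
    ext
    simp
  · intro σ _
    ext
    simp

/-- The conditions on the coupling constants under which the infinite-volume limits exist and are
ergodic. -/
structure IsSummableCoupling (J : Sym2 (Site d) → ℝ) : Prop where
  translation : ∀ x y : Site d, J s(x, y) = J s(0, y - x)
  nonneg : ∀ e : Sym2 (Site d), 0 ≤ J e
  summable : Summable fun x : Site d => J s(0, x)

variable {J : Sym2 (Site d) → ℝ}

lemma IsSummableCoupling.map_add (hJ : IsSummableCoupling J) (x : Site d) (e : Sym2 (Site d)) :
    J (e.map (· + x)) = J e := by
  induction e using Sym2.ind with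
  | _ a b => rw [Sym2.map_mk, hJ.translation, hJ.translation a b, add_sub_add_right_eq_sub]

lemma IsSummableCoupling.forall_mem_shiftEdges (hJ : IsSummableCoupling J)
    {S : Finset (Edge (Site d))} {p : ℝ → Prop} (hp : ∀ e ∈ S, p (J e.1)) (x : Site d) :
    ∀ e ∈ shiftEdges x S, p (J e.1) := by
  intro e he
  obtain ⟨e, h, rfl⟩ := Finset.mem_map.1 he
  exact (hJ.map_add x e.1).symm ▸ hp e h

lemma IsSummableCoupling.ghostCoupling_eq (hJ : IsSummableCoupling J) (G : Finset (Site d))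
    (x : Site d) : ghostCoupling J G x = ∑' y, J s(x, y) - ∑ y ∈ G, J s(x, y) := by
  have hsummable : Summable fun y => J s(x, y) := by
    simp_rw [fun y => hJ.translation x y]
    exact (Equiv.subRight x).summable_iff.2 hJ.summable
  rw [← hsummable.sum_add_tsum_subtype_compl G, add_sub_cancel_left]
  rfl

lemma IsSummableCoupling.ghostCoupling_nonneg (hJ : IsSummableCoupling J) (G : Finset (Site d))
    (x : Site d) : 0 ≤ ghostCoupling J G x := tsum_nonneg fun _ => hJ.nonneg _

lemma IsSummableCoupling.ghostCoupling_eq_insert_add (hJ : IsSummableCoupling J)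
    {G : Finset (Site d)} {z : Site d} (hz : z ∉ G) (x : Site d) :
    ghostCoupling J G x = ghostCoupling J (insert z G) x + J s(z, x) := by
  rw [hJ.ghostCoupling_eq, hJ.ghostCoupling_eq, Finset.sum_insert hz, Sym2.eq_swap]
  ring

lemma IsSummableCoupling.ghostCoupling_shift (hJ : IsSummableCoupling J) (G : Finset (Site d))
    (x y : Site d) : ghostCoupling J (shiftSites x G) (y + x) = ghostCoupling J G y := by
  have hmap : ∀ z, J s(y + x, z + x) = J s(y, z) := fun z => hJ.map_add x s(y, z)
  rw [hJ.ghostCoupling_eq, hJ.ghostCoupling_eq, ← (Equiv.addRight x).tsum_eq]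
  simp [shiftSites, hmap]

lemma IsSummableCoupling.isingMean_shift (hJ : IsSummableCoupling J) (β : ℝ) (h : Site d → ℝ)
    (G : Finset (Site d)) (x : Site d) (f : (Site d → ℤˣ) → ℝ) :
    isingMean J β h (shiftSites x G) (fun σ => f (σ ∘ (· + x))) =
      isingMean J β (fun y => h (y + x)) G f := by
  have hweight : ∀ σ : Site d → ℤˣ, isingWeight J β h (shiftSites x G) σ =
      isingWeight J β (fun y => h (y + x)) G (σ ∘ (· + x)) := by
    intro σ
    rw [isingWeight, isingWeight, ← shiftEdges_edgesIn, shiftEdges, shiftSites, Finset.sum_map,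
      Finset.sum_map]
    simp only [Function.Embedding.coeFn_mk, Edge.map, Equiv.coe_addRight, bond_map, hJ.map_add]
    rfl
  simp_rw [isingMean, mean, hweight]
  rw [sum_spinConfigs_shiftSites x G fun σ => f σ * isingWeight J β (fun y => h (y + x)) G σ,
    sum_spinConfigs_shiftSites x G (isingWeight J β (fun y => h (y + x)) G)]

end Translation

/-! ### Infinite-volume correlations -/

section Limit

variable {d : ℕ}

lemma exists_subset_edgesIn {V : Type} (S : Finset (Edge V)) : ∃ G : Finset V, S ⊆ edgesIn G := by
  classical
  exact ⟨S.biUnion fun e => e.1.toFinset, fun e he => mem_edgesIn.2 fun _ hx =>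
    Finset.mem_biUnion.2 ⟨e, he, Sym2.mem_toFinset.2 hx⟩⟩

lemma eventually_subset_edgesIn {V : Type} (S : Finset (Edge V)) :
    ∀ᶠ G : Finset V in atTop, S ⊆ edgesIn G := by
  obtain ⟨G₀, hG₀⟩ := exists_subset_edgesIn S
  filter_upwards [eventually_ge_atTop G₀] with G hG using hG₀.trans (edgesIn_mono hG)

lemma box_mono (d : ℕ) : Monotone (box d) := by
  intro L L' h
  apply Finset.Icc_subset_Icc <;> intro i <;> simpa using h

lemma exists_mem_box (x : Site d) : ∃ L, x ∈ box d L := by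
  have hle : ∀ i, |x i| ≤ ((∑ i, (x i).natAbs : ℕ) : ℤ) := fun i => by
    rw [Int.abs_eq_natAbs]
    exact_mod_cast Finset.single_le_sum (f := fun i => (x i).natAbs) (fun _ _ => Nat.zero_le _)
      (Finset.mem_univ i)
  exact ⟨∑ i, (x i).natAbs, Finset.mem_Icc.2
    ⟨fun i => neg_le_of_abs_le (hle i), fun i => le_of_abs_le (hle i)⟩⟩

lemma tendsto_box (d : ℕ) : Tendsto (box d) atTop atTop :=
  tendsto_atTop_finset_of_monotone (box_mono d) exists_mem_box

lemma eventually_subset_edgesIn_box (S : Finset (Edge (Site d))) :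
    ∀ᶠ L in atTop, S ⊆ edgesIn (box d L) :=
  (tendsto_box d).eventually (eventually_subset_edgesIn S)

lemma tendsto_shiftSites (x : Site d) : Tendsto (shiftSites x) atTop atTop := by
  refine tendsto_atTop_atTop.2 fun G => ⟨shiftSites (-x) G, fun G' h y hy => ?_⟩
  exact mem_shiftSites.2 (h (mem_shiftSites.2 (by simpa using hy)))

/-- A boundary condition, encoded by the magnetic field `h G` that it creates in each finite volume
`G`, whose correlations are monotone in the volume: they increase with it if `s = -1` (as for free
boundary conditions) and decrease if `s = 1` (as for plus boundary conditions). -/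
structure IsMonotoneField (J : Sym2 (Site d) → ℝ) (s : ℤˣ) (h : Finset (Site d) → Site d → ℝ) :
    Prop where
  nonneg : ∀ G x, 0 ≤ h G x
  shift : ∀ G x y, h (shiftSites x G) (y + x) = h G y
  antitone : ∀ β, 0 ≤ β → ∀ G G' S, G ⊆ G' → S ⊆ edgesIn G →
    sgn s * isingMean J β (h G') G' (bondProd S) ≤ sgn s * isingMean J β (h G) G (bondProd S)

variable {J : Sym2 (Site d) → ℝ}

lemma IsSummableCoupling.isMonotoneField_zero (hJ : IsSummableCoupling J) :
    IsMonotoneField J (-1) 0 where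
  nonneg _ _ := le_rfl
  shift _ _ _ := rfl
  antitone β hβ G G' S hG hS := by
    simpa using isingMean_free_mono hJ.nonneg hβ hG hS

lemma IsSummableCoupling.isMonotoneField_ghostCoupling (hJ : IsSummableCoupling J) :
    IsMonotoneField J 1 (ghostCoupling J) where
  nonneg := hJ.ghostCoupling_nonneg
  shift := hJ.ghostCoupling_shift
  antitone β hβ G G' S hG _ := by
    have hanti : Antitone fun G => isingMean J β (ghostCoupling J G) G (bondProd S) :=
      Finset.antitone_iff_forall_insert_le.2 fun G z hz =>
        isingMean_insert_le hJ.nonneg hβ hz (fun x _ => hJ.ghostCoupling_nonneg _ x)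
          (fun x _ => hJ.ghostCoupling_eq_insert_add hz x) S
    simpa using hanti hG

/-- The infinite-volume correlation of a product of edge spins. -/
def limCorr (J : Sym2 (Site d) → ℝ) (β : ℝ) (h : Finset (Site d) → Site d → ℝ)
    (S : Finset (Edge (Site d))) : ℝ :=
  limUnder atTop fun G => isingMean J β (h G) G (bondProd S)

variable {β : ℝ} {s : ℤˣ} {h : Finset (Site d) → Site d → ℝ} {S : Finset (Edge (Site d))}

lemma tendsto_limCorr (hh : IsMonotoneField J s h) (hβ : 0 ≤ β) :
    Tendsto (fun G => isingMean J β (h G) G (bondProd S)) atTop (𝓝 (limCorr J β h S)) := by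
  obtain ⟨G₀, hG₀⟩ := exists_subset_edgesIn S
  have hanti : Antitone fun G => sgn s * isingMean J β (h (G ∪ G₀)) (G ∪ G₀) (bondProd S) :=
    fun G G' hG => hh.antitone β hβ _ _ S (Finset.union_subset_union_left hG)
      (hG₀.trans (edgesIn_mono Finset.subset_union_right))
  have hbdd : BddBelow (Set.range fun G =>
      sgn s * isingMean J β (h (G ∪ G₀)) (G ∪ G₀) (bondProd S)) := by
    refine ⟨-1, ?_⟩
    rintro _ ⟨G, rfl⟩
    refine neg_le_of_abs_le ?_
    rw [abs_mul, abs_sgn, one_mul]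
    exact abs_isingMean_le fun σ => (abs_bondProd S σ).le
  refine tendsto_nhds_limUnder ⟨_, ((tendsto_atTop_ciInf hanti hbdd).const_mul (sgn s)).congr' ?_⟩
  filter_upwards [eventually_ge_atTop G₀] with G hG
  rw [Finset.union_eq_left.2 hG, ← mul_assoc, sgn_mul_self, one_mul]

lemma sgn_mul_limCorr_le (hh : IsMonotoneField J s h) (hβ : 0 ≤ β) {G : Finset (Site d)}
    (hS : S ⊆ edgesIn G) :
    sgn s * limCorr J β h S ≤ sgn s * isingMean J β (h G) G (bondProd S) := by
  refine le_of_tendsto ((tendsto_limCorr hh hβ).const_mul (sgn s)) ?_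
  filter_upwards [eventually_ge_atTop G] with G' hG using hh.antitone β hβ G G' S hG hS

lemma abs_limCorr_le (hh : IsMonotoneField J s h) (hβ : 0 ≤ β) : |limCorr J β h S| ≤ 1 :=
  le_of_tendsto (tendsto_limCorr hh hβ).abs <| Eventually.of_forall fun _ =>
    abs_isingMean_le fun σ => (abs_bondProd S σ).le

lemma tendsto_isingMean_box (hJ : IsSummableCoupling J) (hh : IsMonotoneField J s h) (hβ : 0 ≤ β)
    (S : Finset (Edge (Site d))) (x : Site d) :
    Tendsto (fun L => isingMean J β (h (box d L)) (box d L) (bondProd (shiftEdges x S))) atTop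
      (𝓝 (limCorr J β h S)) := by
  refine ((tendsto_limCorr hh hβ).comp ((tendsto_shiftSites (-x)).comp (tendsto_box d))).congr
    fun L => ?_
  simp only [Function.comp_apply]
  conv_rhs => rw [← shiftSites_shiftSites_neg x (box d L), bondProd_shiftEdges, hJ.isingMean_shift]
  simp_rw [hh.shift]

/-! ### Exponential moments -/

/-- The temperature is moved in the direction in which the correlations, as monotone limits of
continuous functions, are semicontinuous. -/
lemma exists_sgn_mul_limCorr_lt (hh : IsMonotoneField J s h) (hβ : 0 < β) {η : ℝ} (hη : 0 < η) :
    ∃ β' > 0, 0 < sgn s * (β' - β) ∧ sgn s * limCorr J β' h S < sgn s * limCorr J β h S + η := by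
  obtain ⟨G, hG, hS⟩ := ((((tendsto_limCorr (S := S) hh hβ.le).const_mul (sgn s)).eventually
    (gt_mem_nhds (lt_add_of_pos_right _ hη))).and (eventually_subset_edgesIn S)).exists
  have hnear : ∀ᶠ β' in 𝓝 β, 0 < β' ∧
      sgn s * isingMean J β' (h G) G (bondProd S) < sgn s * limCorr J β h S + η :=
    (lt_mem_nhds hβ).and ((((continuous_isingMean (bondProd S)).tendsto β).const_mul
      (sgn s)).eventually (gt_mem_nhds hG))
  have hside : Tendsto (fun t : ℝ => β + sgn s * t) (𝓝[>] 0) (𝓝 β) :=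
    tendsto_nhdsWithin_of_tendsto_nhds (Continuous.tendsto' (by fun_prop) _ _ (by simp))
  obtain ⟨t, ⟨hpos, hlt⟩, ht⟩ := ((hside.eventually hnear).and self_mem_nhdsWithin).exists
  refine ⟨β + sgn s * t, hpos, ?_, (sgn_mul_limCorr_le hh hpos.le hS).trans_lt hlt⟩
  rwa [add_sub_cancel_left, ← mul_assoc, sgn_mul_self, one_mul]

lemma exists_pos_forall_le {ι : Type*} (S : Finset ι) {f : ι → ℝ} (hf : ∀ i ∈ S, 0 < f i) :
    ∃ c > 0, ∀ i ∈ S, c ≤ f i := by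
  rcases S.eq_empty_or_nonempty with rfl | hne
  · exact ⟨1, one_pos, by simp⟩
  · obtain ⟨i, hi, h⟩ := S.exists_min_image f hne
    exact ⟨f i, hf i hi, h⟩

/-- Distant products of edge spins have the exponential moments of independent variables, up to an
error absorbed by a small change of temperature. -/
lemma exists_isingMean_tilt_le (hJ : IsSummableCoupling J) (hh : IsMonotoneField J s h) (hβ : 0 < β)
    (hS : ∀ e ∈ S, 0 < J e.1) {η : ℝ} (hη : 0 < η) :
    ∃ a₀ > 0, ∀ a, 0 < a → a ≤ a₀ → ∀ T : Finset (Site d),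
      (T : Set (Site d)).PairwiseDisjoint (fun y => shiftEdges y S) →
      ∀ᶠ L in atTop,
        isingMean J β (h (box d L)) (box d L) (tilt (a * sgn s) (fun y => shiftEdges y S) T) ≤
          (1 + a * (sgn s * limCorr J β h S + η)) ^ T.card := by
  obtain ⟨β', hβ', hside, hlim⟩ := exists_sgn_mul_limCorr_lt (S := S) hh hβ hη
  obtain ⟨c, hc, hcJ⟩ := exists_pos_forall_le S fun e he => mul_pos hside (hS e he)
  have htanh : 0 < Real.tanh c := by
    rw [Real.tanh_eq_sinh_div_cosh]
    exact div_pos (Real.sinh_pos_iff.2 hc) (Real.cosh_pos c)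
  refine ⟨min (1 / 2) (Real.tanh c ^ S.card), lt_min (by norm_num) (pow_pos htanh _),
    fun a ha ha₀ T hT => ?_⟩
  have habs : |a * sgn s| = a := by rw [abs_mul, abs_sgn, mul_one, abs_of_pos ha]
  have ha1 : |a * sgn s| < 1 := by linarith [ha₀.trans (min_le_left _ _)]
  have hcorr : ∀ᶠ L in atTop, ∀ x ∈ T,
      sgn s * isingMean J β' (h (box d L)) (box d L) (bondProd (shiftEdges x S)) <
        sgn s * limCorr J β h S + η :=
    (eventually_all_finset T).2 fun x _ =>
      ((tendsto_isingMean_box hJ hh hβ'.le S x).const_mul (sgn s)).eventually (gt_mem_nhds hlim)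
  have hsub : ∀ᶠ L in atTop, ∀ y ∈ T, shiftEdges y S ⊆ edgesIn (box d L) :=
    (eventually_all_finset T).2 fun y _ => eventually_subset_edgesIn_box (shiftEdges y S)
  filter_upwards [hcorr, hsub] with L hcorr hsub
  refine isingMean_tilt_le ha1 fun t ht x hx => ?_
  have htilt := sgn_mul_mean_tilt_le (t := t) s hJ.nonneg (fun x _ => hh.nonneg (box d L) x) hβ.le
    hβ'.le hside.le (fun y hy => hsub y (ht hy)) (hT.subset (Finset.coe_subset.2 ht)) hc
    (fun y _ => hJ.forall_mem_shiftEdges (p := fun r => c ≤ sgn s * (β' - β) * r) hcJ y) ha1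
    (fun y _ => by
      rw [habs, shiftEdges, Finset.card_map]
      exact ha₀.trans (min_le_right _ _)) (shiftEdges x S)
  rw [mul_assoc]
  exact mul_le_mul_of_nonneg_left (htilt.trans (hcorr x hx).le) ha.le

end Limit

/-! ### Currents on a finite graph -/

section Currents

/-- The configurations that agree with `m` on `E`. -/
def cyl {I S : Type*} (E : Finset I) (m : I → S) : Set (I → S) := {ω | ∀ e ∈ E, ω e = m e}

lemma measurableSet_cyl {I S : Type*} [MeasurableSpace S] [MeasurableSingletonClass S]
    (E : Finset I) (m : I → S) : MeasurableSet (cyl E m) :=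
  MeasurableSet.pi E.countable_toSet fun e _ => measurableSet_singleton (m e)

lemma integral_count_eq_tsum {α : Type*} [Countable α] [MeasurableSpace α]
    [MeasurableSingletonClass α] {f : α → ℝ} (hf : Summable f) :
    ∫ a, f a ∂Measure.count = ∑' a, f a := by
  simp [integral_countable (integrable_count_iff.2 hf.norm)]

lemma hasSum_pi_prod {I : Type*} [Fintype I] {t : I → ℕ → ℝ} (ht : ∀ i, Summable (t i)) :
    HasSum (fun n : I → ℕ => ∏ i, t i (n i)) (∏ i, ∑' k, t i k) := by
  have hcount : Measure.pi (fun _ : I => (Measure.count : Measure ℕ)) = Measure.count :=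
    Measure.ext_of_singleton fun n => by simp [Measure.pi_singleton]
  have hint := Integrable.fintype_prod (μ := fun _ : I => Measure.count) fun i =>
    integrable_count_iff.2 (ht i).norm
  have hprod := integral_fintype_prod_eq_prod (μ := fun _ : I => Measure.count) t
  rw [hcount, integrable_count_iff] at hint
  rw [hcount, integral_count_eq_tsum hint.of_norm] at hprod
  simp_rw [fun i => integral_count_eq_tsum (ht i)] at hprod
  exact hprod ▸ hint.of_norm.hasSum

lemma hasSum_pow_div_factorial (x : ℝ) : HasSum (fun k : ℕ => x ^ k / k !) (Real.exp x) := by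
  rw [Real.exp_eq_exp_ℝ]
  exact NormedSpace.expSeries_div_hasSum_exp x

/-- The factor by which prescribing the value `k` of the current at an edge of weight `a` and spin
product `u` changes the factor `exp (a u)` of that edge in the Ising weight. -/
def currentFactor (a : ℝ) (k : ℕ) (u : ℤˣ) : ℝ := a ^ k / k ! * sgn u ^ k * Real.exp (-(a * sgn u))

lemma currentFactor_mul_exp (a : ℝ) (k : ℕ) (u : ℤˣ) :
    currentFactor a k u * Real.exp (a * sgn u) = (a * sgn u) ^ k / k ! := by
  rw [currentFactor, mul_assoc, ← Real.exp_add, neg_add_cancel, Real.exp_zero, mul_pow]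
  ring

lemma hasSum_indicator_cyl {I : Type*} [Fintype I] (a : I → ℝ) (u : I → ℤˣ) (F : Finset I)
    (m : I → ℕ) :
    HasSum ((cyl F m).indicator fun n => ∏ i, (a i * sgn (u i)) ^ n i / (n i)!)
      ((∏ i ∈ F, currentFactor (a i) (m i) (u i)) * Real.exp (∑ i, a i * sgn (u i))) := by
  classical
  let t : I → ℕ → ℝ := fun i k => if i ∈ F ∧ k ≠ m i then 0 else (a i * sgn (u i)) ^ k / (k !)
  have htsum : ∀ i, HasSum (t i)
      ((if i ∈ F then currentFactor (a i) (m i) (u i) else 1) * Real.exp (a i * sgn (u i))) := by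
    intro i
    by_cases hi : i ∈ F
    · rw [if_pos hi, currentFactor_mul_exp]
      convert hasSum_single (f := t i) (m i) fun k hk => if_pos ⟨hi, hk⟩ using 1
      simp [t]
    · simpa [t, hi] using hasSum_pow_div_factorial (a i * sgn (u i))
  have hprod := hasSum_pi_prod fun i => (htsum i).summable
  simp_rw [fun i => (htsum i).tsum_eq] at hprod
  rw [Finset.prod_mul_distrib, Finset.prod_ite_mem, Finset.univ_inter, ← Real.exp_sum] at hprod
  convert hprod using 1
  funext n
  by_cases hn : n ∈ cyl F m
  · rw [Set.indicator_of_mem hn]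
    exact Finset.prod_congr rfl fun i _ => (if_neg fun h => h.2 (hn i h.1)).symm
  · rw [Set.indicator_of_notMem hn]
    simp only [cyl, Set.mem_ofPred_eq, not_forall] at hn
    obtain ⟨i, hi, hne⟩ := hn
    exact (Finset.prod_eq_zero (f := fun i => t i (n i)) (Finset.mem_univ i)
      (if_pos ⟨hi, hne⟩)).symm

variable {V : Type} [DecidableEq V] {U : Finset V}

lemma bond_mulSingle (v : V) (e : Edge V) :
    bond e.1 (Pi.mulSingle v (-1)) = if v ∈ e.1 then -1 else 1 := by
  obtain ⟨e, he⟩ := e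
  induction e using Sym2.ind with
  | _ x y =>
    have hxy : x ≠ y := by simpa using he
    by_cases hx : v = x
    · subst hx
      simp [hxy.symm]
    · by_cases hy : v = y
      · subst hy
        simp [hxy]
      · simp [hx, hy, Ne.symm hx, Ne.symm hy, Pi.mulSingle_eq_of_ne]

variable [Fintype V] {β : ℝ} {K : Edge V → ℝ}

/-- The currents that have no sources in `U`. -/
def noSources (U : Finset V) : Set (Current V) := {n | ∀ v ∈ U, v ∉ sources n}

/-- The character `σ ↦ ∏ (σ_x σ_y)^{n_{x,y}}` defined by a current. -/
def currentChar (n : Current V) : (V → ℤˣ) →* ℤˣ := ∏ e : Edge V, bond e.1 ^ n e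

lemma sgn_currentChar (n : Current V) (σ : V → ℤˣ) :
    sgn (currentChar n σ) = ∏ e : Edge V, sgn (bond e.1 σ) ^ n e := by
  simp only [currentChar, MonoidHom.finsetProd_apply, MonoidHom.pow_apply, map_prod, map_pow]

lemma currentChar_mulSingle (n : Current V) (v : V) :
    currentChar n (Pi.mulSingle v (-1)) = (-1) ^ ∑ e : Edge V, if v ∈ e.1 then n e else 0 := by
  simp only [currentChar, MonoidHom.finsetProd_apply, MonoidHom.pow_apply, bond_mulSingle, ite_pow,
    one_pow, ← Finset.prod_pow_eq_pow_sum, pow_ite, pow_zero]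

lemma currentChar_eq_one {n : Current V} (hn : n ∈ noSources U) {σ : V → ℤˣ}
    (hσ : σ ∈ spinConfigs U) : currentChar n σ = 1 := by
  rw [← Finset.univ_prod_mulSingle σ, map_prod]
  refine Finset.prod_eq_one fun v _ => ?_
  rcases Int.units_eq_one_or (σ v) with h | h
  · rw [h, Pi.mulSingle_one, map_one]
  · have hv : v ∈ U := by
      by_contra hv
      exact absurd ((mem_spinConfigs.1 hσ v hv).symm.trans h) (by decide)
    rw [h, currentChar_mulSingle]
    exact (Nat.not_odd_iff_even.1 (hn v hv)).neg_one_pow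

lemma indicator_noSources (U : Finset V) (n : Current V) :
    (noSources U).indicator (fun _ => (1 : ℝ)) n =
      ((spinConfigs U).card : ℝ)⁻¹ * ∑ σ ∈ spinConfigs U, sgn (currentChar n σ) := by
  by_cases hn : n ∈ noSources U
  · have hcard : ((spinConfigs U).card : ℝ) ≠ 0 :=
      Nat.cast_ne_zero.2 (Finset.card_ne_zero_of_mem (one_mem_spinConfigs U))
    rw [Set.indicator_of_mem hn, Finset.sum_congr rfl fun σ hσ => by
      rw [currentChar_eq_one hn hσ, map_one], Finset.sum_const, nsmul_one, inv_mul_cancel₀ hcard]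
  · rw [Set.indicator_of_notMem hn]
    simp only [noSources, Set.mem_ofPred_eq, not_forall, not_not] at hn
    obtain ⟨v, hv, hodd⟩ := hn
    rw [sum_sgn_eq_zero mul_mem_spinConfigs (currentChar n) (mulSingle_mem_spinConfigs hv (-1)),
      mul_zero]
    rw [currentChar_mulSingle]
    exact Odd.neg_one_pow hodd

lemma weight_nonneg (hK : ∀ e, 0 ≤ β * K e) (n : Current V) : 0 ≤ weight β K n :=
  Finset.prod_nonneg fun e _ => div_nonneg (pow_nonneg (hK e) _) (Nat.cast_nonneg _)

lemma hasSum_indicator_weight (β : ℝ) (K : Edge V → ℝ) (U : Finset V) (F : Finset (Edge V))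
    (m : Current V) :
    HasSum ((cyl F m).indicator ((noSources U).indicator (weight β K)))
      (((spinConfigs U).card : ℝ)⁻¹ * ∑ σ ∈ spinConfigs U,
        (∏ e ∈ F, currentFactor (β * K e) (m e) (bond e.1 σ)) *
          Real.exp (∑ e, β * K e * sgn (bond e.1 σ))) := by
  refine ((hasSum_sum fun σ (_ : σ ∈ spinConfigs U) => hasSum_indicator_cyl (fun e => β * K e)
    (fun e : Edge V => bond e.1 σ) F m).mul_left ((spinConfigs U).card : ℝ)⁻¹).congr_fun fun n => ?_
  by_cases hn : n ∈ cyl F m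
  · have hsplit : ∀ σ, ∏ e : Edge V, (β * K e * sgn (bond e.1 σ)) ^ n e / (n e)! =
        weight β K n * sgn (currentChar n σ) := fun σ => by
      rw [sgn_currentChar, weight, ← Finset.prod_mul_distrib]
      exact Finset.prod_congr rfl fun e _ => by rw [mul_pow, mul_div_right_comm]
    simp_rw [Set.indicator_of_mem hn, hsplit]
    rw [← Finset.mul_sum, mul_left_comm, ← indicator_noSources]
    by_cases hU : n ∈ noSources U <;> simp [hU]
  · simp_rw [Set.indicator_of_notMem hn, Finset.sum_const_zero, mul_zero]

lemma lawOn_apply (hK : ∀ e, 0 ≤ β * K e) (S A : Set (Current V))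
    (hA : Summable (A.indicator (S.indicator (weight β K)))) :
    lawOn β K S A = ENNReal.ofReal
      ((∑' n, A.indicator (S.indicator (weight β K)) n) / ∑' n, S.indicator (weight β K) n) := by
  have hnonneg : ∀ n, 0 ≤ S.indicator (weight β K) n :=
    Set.indicator_nonneg fun n _ => weight_nonneg hK n
  have hterm : ∀ n, (ENNReal.ofReal (S.indicator (weight β K) n /
      ∑' m, S.indicator (weight β K) m) • Measure.dirac n) A =
        ENNReal.ofReal (A.indicator (S.indicator (weight β K)) n /
          ∑' m, S.indicator (weight β K) m) := by
    intro n
    rw [Measure.smul_apply, Measure.dirac_apply' _ MeasurableSet.of_discrete, smul_eq_mul]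
    by_cases hn : n ∈ A
    · rw [Set.indicator_of_mem hn, Set.indicator_of_mem hn, Pi.one_apply, mul_one]
    · rw [Set.indicator_of_notMem hn, Set.indicator_of_notMem hn, mul_zero, zero_div,
        ENNReal.ofReal_zero]
  rw [lawOn, Measure.sum_apply _ MeasurableSet.of_discrete]
  simp_rw [hterm]
  rw [← ENNReal.ofReal_tsum_of_nonneg ?_ (hA.div_const _), tsum_div_const]
  exact fun n => div_nonneg (Set.indicator_nonneg (fun n _ => hnonneg n) n) (tsum_nonneg hnonneg)

theorem lawOn_real_cyl (hK : ∀ e, 0 ≤ β * K e) (U : Finset V) (F : Finset (Edge V))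
    (m : Current V) :
    (lawOn β K (noSources U)).real (cyl F m) =
      mean (spinConfigs U) (fun σ => Real.exp (∑ e, β * K e * sgn (bond e.1 σ)))
        fun σ => ∏ e ∈ F, currentFactor (β * K e) (m e) (bond e.1 σ) := by
  have hF := hasSum_indicator_weight β K U F m
  have hZ := hasSum_indicator_weight β K U ∅ m
  have hnonneg : ∀ n, 0 ≤ (noSources U).indicator (weight β K) n :=
    Set.indicator_nonneg fun n _ => weight_nonneg hK n
  have hcard : ((spinConfigs U).card : ℝ)⁻¹ ≠ 0 :=
    inv_ne_zero (Nat.cast_ne_zero.2 (Finset.card_ne_zero_of_mem (one_mem_spinConfigs U)))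
  simp only [cyl, Finset.notMem_empty, false_imp_iff, implies_true, Set.ofPred_true,
    Set.indicator_univ, Finset.prod_empty, one_mul] at hZ
  rw [measureReal_def, lawOn_apply hK _ _ hF.summable, ENNReal.toReal_ofReal (div_nonneg
    (tsum_nonneg (Set.indicator_nonneg fun n _ => hnonneg n)) (tsum_nonneg hnonneg)),
    hF.tsum_eq, hZ.tsum_eq, mul_div_mul_left _ _ hcard, mean]

lemma isProbabilityMeasure_lawOn (hK : ∀ e, 0 ≤ β * K e) (U : Finset V) :
    IsProbabilityMeasure (lawOn β K (noSources U)) := by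
  have hcyl := lawOn_real_cyl hK U ∅ 0
  simp only [cyl, Finset.notMem_empty, false_imp_iff, implies_true, Set.ofPred_true,
    Finset.prod_empty] at hcyl
  rw [mean_const (Finset.sum_pos (fun _ _ => Real.exp_pos _) ⟨1, one_mem_spinConfigs U⟩),
    measureReal_def, ENNReal.toReal_eq_one_iff] at hcyl
  exact ⟨hcyl⟩

end Currents

/-! ### The laws of the currents in a finite volume -/

section BoxLaws

variable {d : ℕ} {J : Sym2 (Site d) → ℝ} {β : ℝ} {h : Site d → ℝ} {G : Finset (Site d)}

/-- The function of the spins whose mean value in the Ising model is the probability that the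
current agrees with `m` on `E`. -/
def cylFun (J : Sym2 (Site d) → ℝ) (β : ℝ) (E : Finset (Edge (Site d))) (m : Current (Site d))
    (σ : Site d → ℤˣ) : ℝ :=
  ∏ e ∈ E, currentFactor (β * J e.1) (m e) (bond e.1 σ)

/-- `ν` is the law of a sourceless current on `G`: the currents vanish off `G`, and the cylinder
probabilities are mean values in the Ising model on `G`, where the field `h` stands for the
boundary condition. -/
structure IsCurrentLaw (J : Sym2 (Site d) → ℝ) (β : ℝ) (h : Site d → ℝ) (G : Finset (Site d))
    (ν : Measure (Current (Site d))) : Prop where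
  isProbability : IsProbabilityMeasure ν
  real_cyl : ∀ (E : Finset (Edge (Site d))) (m : Current (Site d)), E ⊆ edgesIn G →
    ν.real (cyl E m) = isingMean J β h G (cylFun J β E m)
  support : ∀ e ∉ edgesIn G, ν {ω | ω e ≠ 0} = 0

lemma extendCurrent_apply (n : Current G) (e : Edge G) :
    extendCurrent G n (e.map (Function.Embedding.subtype (· ∈ G))) = n e :=
  (Edge.map_injective _).extend_apply _ _ _

lemma extendCurrent_of_notMem (n : Current G) {e : Edge (Site d)} (he : e ∉ edgesIn G) :
    extendCurrent G n e = 0 := by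
  refine Function.extend_apply' _ _ _ ?_
  rintro ⟨e, rfl⟩
  refine he (mem_edgesIn.2 fun x hx => ?_)
  obtain ⟨y, -, rfl⟩ := Sym2.mem_map.1 hx
  exact y.2

lemma sum_edgesIn (G : Finset (Site d)) (F : Edge (Site d) → ℝ) :
    ∑ e ∈ edgesIn G, F e = ∑ e : Edge G, F (e.map (Function.Embedding.subtype (· ∈ G))) := by
  rw [edgesIn, Finset.sum_map]
  exact Finset.sum_congr (by congr!) fun _ _ => rfl

lemma sum_spinConfigs_map {V W : Type} [Fintype W] [DecidableEq W] (f : W ↪ V)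
    (F : (V → ℤˣ) → ℝ) :
    ∑ σ ∈ spinConfigs (Finset.univ.map f), F σ = ∑ τ : W → ℤˣ, F (Function.extend f τ 1) := by
  have hextend : ∀ σ ∈ spinConfigs (Finset.univ.map f), Function.extend f (σ ∘ f) 1 = σ := by
    intro σ hσ
    funext x
    by_cases hx : ∃ y, f y = x
    · obtain ⟨y, rfl⟩ := hx
      exact f.injective.extend_apply _ _ y
    · rw [Function.extend_apply' _ _ _ hx, Pi.one_apply,
        mem_spinConfigs.1 hσ x fun h => hx (by simpa using h)]
  refine Finset.sum_nbij' (· ∘ f) (Function.extend f · 1) (fun _ _ => Finset.mem_univ _) ?_ hextend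
    (fun τ _ => funext fun x => f.injective.extend_apply _ _ x)
    fun σ hσ => congrArg F (hextend σ hσ).symm
  refine fun τ _ => mem_spinConfigs.2 fun x hx => Function.extend_apply' _ _ _ ?_
  rintro ⟨y, rfl⟩
  exact hx (Finset.mem_map_of_mem f (Finset.mem_univ y))

lemma mean_spinConfigs_map {V W : Type} [Fintype W] [DecidableEq W] (f : W ↪ V)
    (w F : (V → ℤˣ) → ℝ) :
    mean (spinConfigs (Finset.univ.map f)) w F = mean Finset.univ
      (fun τ : W → ℤˣ => w (Function.extend f τ 1)) fun τ => F (Function.extend f τ 1) := by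
  rw [mean, mean, sum_spinConfigs_map, sum_spinConfigs_map]

lemma bond_map_extend {V W : Type} (f : W ↪ V) (e : Edge W) (τ : W → ℤˣ) :
    bond (e.map f).1 (Function.extend f τ 1) = bond e.1 τ := by
  rw [Edge.map, bond_map, Function.extend_comp f.injective]

lemma isingMean_eq_mean (F : (Site d → ℤˣ) → ℝ) :
    isingMean J β h G F = mean Finset.univ
      (fun τ : G → ℤˣ => Real.exp (∑ e : Edge G, β * freeCoupling J G e * sgn (bond e.1 τ) +
        ∑ x : G, β * h x * sgn (τ x))) fun τ =>
          F (Function.extend (Function.Embedding.subtype (· ∈ G)) τ 1) := by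
  have hG : Finset.univ.map (Function.Embedding.subtype (· ∈ G)) = G := by ext; simp
  conv_lhs => rw [isingMean, ← hG, mean_spinConfigs_map, hG]
  congr 1
  funext τ
  have hval (x : G) : Function.extend (Function.Embedding.subtype (· ∈ G)) τ 1 x.1 = τ x :=
    (Function.Embedding.subtype (· ∈ G)).injective.extend_apply τ 1 x
  rw [isingWeight, sum_edgesIn, ← Finset.sum_coe_sort G]
  simp only [bond_map_extend, hval]
  rfl

lemma extendCurrent_preimage_cyl {V : Type} (f : G ↪ V) (E : Finset (Edge G))
    (m : Current (Site d)) :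
    (fun n : Current V => extendCurrent G fun e => n (e.map f)) ⁻¹'
        cyl (E.map ⟨Edge.map (Function.Embedding.subtype (· ∈ G)), Edge.map_injective _⟩) m =
      cyl (E.map ⟨Edge.map f, Edge.map_injective f⟩) (Function.extend (Edge.map f)
        (fun e => m (e.map (Function.Embedding.subtype (· ∈ G)))) 0) := by
  ext n
  simp only [cyl, Set.mem_preimage, Set.mem_ofPred_eq, Finset.forall_mem_map,
    Function.Embedding.coeFn_mk, extendCurrent_apply, (Edge.map_injective f).extend_apply]

variable {V : Type} [Fintype V] [DecidableEq V] {K : Edge V → ℝ} {f : G ↪ V}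

/-- The graph on `V` consists of `G` and possibly further vertices, whose spins are set to `1` and
which act on the spins in `G` as the magnetic field `h`. -/
theorem isCurrentLaw_map (hK : ∀ e, 0 ≤ β * K e) (hKf : ∀ e, K (e.map f) = freeCoupling J G e)
    (hh : ∀ τ : G → ℤˣ, ∑ e, β * K e * sgn (bond e.1 (Function.extend f τ 1)) =
      ∑ e : Edge G, β * freeCoupling J G e * sgn (bond e.1 τ) + ∑ x : G, β * h x * sgn (τ x)) :
    IsCurrentLaw J β h G ((lawOn β K (noSources (Finset.univ.map f))).map
      fun n => extendCurrent G fun e => n (e.map f)) := by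
  have hmeas : Measurable fun n : Current V => extendCurrent G fun e => n (e.map f) :=
    measurable_of_countable _
  have := isProbabilityMeasure_lawOn hK (Finset.univ.map f)
  refine ⟨Measure.isProbabilityMeasure_map hmeas.aemeasurable, fun E m hE => ?_, fun e he => ?_⟩
  · obtain ⟨E, -, rfl⟩ := Finset.subset_map_iff.1 hE
    rw [map_measureReal_apply hmeas (measurableSet_cyl _ m), extendCurrent_preimage_cyl,
      lawOn_real_cyl hK, mean_spinConfigs_map, isingMean_eq_mean]
    simp_rw [hh]
    congr 1
    funext τ
    rw [cylFun, Finset.prod_map, Finset.prod_map]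
    refine Finset.prod_congr rfl fun e _ => ?_
    simp only [Function.Embedding.coeFn_mk, bond_map_extend, hKf,
      (Edge.map_injective f).extend_apply]
    rfl
  · have hzero : MeasurableSet {ω : Current (Site d) | ω e ≠ 0} :=
      measurable_pi_apply e (measurableSet_singleton 0).compl
    rw [Measure.map_apply hmeas hzero]
    simp [extendCurrent_of_notMem _ he]

theorem isCurrentLaw_free (hJ : ∀ e, 0 ≤ J e) (hβ : 0 ≤ β) (G : Finset (Site d)) :
    IsCurrentLaw J β 0 G ((freeLaw J β G).map (extendCurrent G)) := by
  have hset : {n : Current G | sources n = ∅} =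
      noSources (Finset.univ.map (Function.Embedding.refl G)) := by
    ext n
    simp [noSources, Set.eq_empty_iff_forall_notMem]
  have hmap : ∀ e : Edge G, e.map (Function.Embedding.refl G) = e := fun e =>
    Subtype.ext (congrFun Sym2.map_id e.1)
  have hlaw : IsCurrentLaw J β 0 G ((lawOn β (freeCoupling J G)
      (noSources (Finset.univ.map (Function.Embedding.refl G)))).map
        fun n => extendCurrent G fun e => n (e.map (Function.Embedding.refl G))) :=
    isCurrentLaw_map (fun e => mul_nonneg hβ (hJ _)) (fun e => by rw [hmap]) fun τ => by
      have hτ : Function.extend (Function.Embedding.refl G) τ 1 = τ :=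
        funext fun x => (Function.Embedding.refl G).injective.extend_apply τ 1 x
      simp [hτ]
  rw [freeLaw, hset]
  simpa only [hmap] using hlaw

lemma sum_edge_option {W : Type} [Fintype W] [DecidableEq W] (F : Edge (Option W) → ℝ) :
    ∑ e, F e = ∑ e : Edge W, F (e.map Function.Embedding.some) +
      ∑ x : W, F ⟨s(none, some x), by simp⟩ := by
  let g : Edge W ⊕ W → Edge (Option W) :=
    Sum.elim (Edge.map Function.Embedding.some) fun x => ⟨s(none, some x), by simp⟩
  have hg : Function.Bijective g := by
    constructor
    · refine (Edge.map_injective _).sumElim (fun x y hxy => ?_) fun e x he => ?_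
      · simpa using hxy
      · obtain ⟨y, -, hy⟩ := Sym2.mem_map.1 (show none ∈ (e.map Function.Embedding.some).1 by
          rw [he]
          simp)
        exact Option.some_ne_none y hy
    · rintro ⟨e, he⟩
      induction e using Sym2.ind with
      | _ x y =>
        rcases x with _ | x <;> rcases y with _ | y
        · exact absurd rfl he
        · exact ⟨.inr y, rfl⟩
        · exact ⟨.inr x, Subtype.ext Sym2.eq_swap⟩
        · exact ⟨.inl ⟨s(x, y), by simpa using he⟩, rfl⟩
  rw [← hg.sum_comp, Fintype.sum_sum_type]
  rfl

lemma plusCoupling_nonneg (hJ : ∀ e, 0 ≤ J e) (e : Edge (Option G)) : 0 ≤ plusCoupling J G e := by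
  have hghost : ∀ x, 0 ≤ ghostCoupling J G x := fun x => tsum_nonneg fun y => hJ _
  obtain ⟨e, he⟩ := e
  induction e using Sym2.ind with
  | _ x y =>
    rcases x with _ | x <;> rcases y with _ | y
    · exact le_rfl
    · exact hghost y
    · exact hghost x
    · exact hJ _

lemma plusCoupling_map_some (e : Edge G) :
    plusCoupling J G (e.map Function.Embedding.some) = freeCoupling J G e := by
  obtain ⟨e, he⟩ := e
  induction e using Sym2.ind with
  | _ x y => rfl

theorem isCurrentLaw_plus (hJ : ∀ e, 0 ≤ J e) (hβ : 0 ≤ β) (G : Finset (Site d)) :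
    IsCurrentLaw J β (ghostCoupling J G) G
      ((plusLaw J β G).map fun n => extendCurrent G (forgetGhost G n)) := by
  have hset : {n : Current (Option G) | {x : G | some x ∈ sources n} = ∅} =
      noSources (Finset.univ.map Function.Embedding.some) := by
    ext n
    simp only [noSources, Set.mem_ofPred_eq, Set.eq_empty_iff_forall_notMem,
      Finset.forall_mem_map, Finset.mem_univ, forall_const]
    rfl
  rw [plusLaw, hset]
  refine isCurrentLaw_map (f := Function.Embedding.some)
    (fun e => mul_nonneg hβ (plusCoupling_nonneg hJ e)) plusCoupling_map_some fun τ => ?_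
  have hnone : Function.extend Function.Embedding.some τ 1 none = 1 :=
    Function.extend_apply' _ _ _ (by simp)
  have hsome (x : G) : Function.extend Function.Embedding.some τ 1 (some x) = τ x :=
    Function.Embedding.some.injective.extend_apply τ 1 x
  rw [sum_edge_option]
  simp only [plusCoupling_map_some, bond_map_extend, bond_mk]
  refine congrArg₂ _ rfl (Finset.sum_congr rfl fun x _ => ?_)
  rw [hnone, hsome, one_mul]
  rfl

end BoxLaws

/-! ### Concentration -/

section Concentration

variable {X ι : Type*} {C : Finset X} {w : X → ℝ} {T : Finset ι} {Y : ι → X → ℝ} {a M η : ℝ}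

lemma exp_sub_two_mul_sq_le {u : ℝ} (hu : |u| ≤ 1 / 2) : Real.exp (u - 2 * u ^ 2) ≤ 1 + u := by
  have hu' : -(1 / 2) ≤ u := (abs_le.1 hu).1
  have hpos : 0 < 1 + u := by linarith
  have hlog : u - 2 * u ^ 2 ≤ 1 - (1 + u)⁻¹ := by
    rw [le_sub_comm, inv_le_iff_one_le_mul₀ hpos]
    nlinarith [mul_nonneg (sq_nonneg u) (by linarith : 0 ≤ 1 + 2 * u)]
  rw [← Real.le_log_iff_exp_le hpos]
  exact hlog.trans (Real.one_sub_inv_le_log_of_pos hpos)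

lemma exp_sum_le_prod {y : ι → ℝ} (hy : ∀ i ∈ T, |y i| ≤ 1) (ha : 0 ≤ a) (ha' : a ≤ 1 / 2) :
    Real.exp (a * ∑ i ∈ T, y i - 2 * a ^ 2 * T.card) ≤ ∏ i ∈ T, (1 + a * y i) := by
  have hsum : a * ∑ i ∈ T, y i - 2 * a ^ 2 * T.card = ∑ i ∈ T, (a * y i - 2 * a ^ 2) := by
    rw [Finset.sum_sub_distrib, Finset.mul_sum, Finset.sum_const, nsmul_eq_mul]
    ring
  rw [hsum, Real.exp_sum]
  refine Finset.prod_le_prod (fun _ _ => (Real.exp_pos _).le) fun i hi => ?_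
  refine (Real.exp_le_exp.2 ?_).trans (exp_sub_two_mul_sq_le (u := a * y i) ?_)
  · nlinarith [sq_nonneg a, (sq_le_one_iff_abs_le_one _).2 (hy i hi)]
  · rw [abs_mul, abs_of_nonneg ha]
    nlinarith [hy i hi, abs_nonneg (y i)]

lemma mean_exp_le_one (hw : ∀ σ ∈ C, 0 ≤ w σ) (hY : ∀ i σ, |Y i σ| ≤ 1) (hM : |M| ≤ 1)
    (ha : 0 < a) (ha' : a ≤ 1 / 2) (haη : 2 * a ≤ η)
    (hprod : mean C w (fun σ => ∏ i ∈ T, (1 + a * Y i σ)) ≤ (1 + a * (M + η)) ^ T.card) :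
    mean C w (fun σ => Real.exp (a * (∑ i ∈ T, Y i σ - T.card * (M + 2 * η)))) ≤ 1 := by
  have hpoint : ∀ σ, Real.exp (a * (∑ i ∈ T, Y i σ - T.card * (M + 2 * η))) ≤
      Real.exp (-(T.card * (a * (M + η)))) * ∏ i ∈ T, (1 + a * Y i σ) := by
    intro σ
    refine le_trans ?_ (mul_le_mul_of_nonneg_left (exp_sum_le_prod (fun i _ => hY i σ) ha.le ha')
      (Real.exp_pos _).le)
    rw [← Real.exp_add, Real.exp_le_exp]
    nlinarith [mul_nonneg (mul_nonneg ha.le (Nat.cast_nonneg (α := ℝ) T.card))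
      (sub_nonneg.2 haη)]
  have hpow : (1 + a * (M + η)) ^ T.card ≤ Real.exp (T.card * (a * (M + η))) := by
    rw [Real.exp_nat_mul]
    refine pow_le_pow_left₀ ?_ (by linarith [Real.add_one_le_exp (a * (M + η))]) _
    nlinarith [(abs_le.1 hM).1]
  calc _ ≤ Real.exp (-(T.card * (a * (M + η)))) * mean C w fun σ => ∏ i ∈ T, (1 + a * Y i σ) :=
        (mean_mono hw fun σ _ => hpoint σ).trans_eq (mean_const_mul _ _ _)
    _ ≤ Real.exp (-(T.card * (a * (M + η)))) * Real.exp (T.card * (a * (M + η))) :=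
        mul_le_mul_of_nonneg_left (hprod.trans hpow) (Real.exp_pos _).le
    _ = 1 := by rw [← Real.exp_add, neg_add_cancel, Real.exp_zero]

lemma abs_le_add_exp_sub {c z : ℝ} (hc : 0 < c) (hη : 0 ≤ η) :
    |z| ≤ 4 * η + 2 * c⁻¹ * Real.exp (c * (z - 2 * η)) - z := by
  have hexp : z - 2 * η ≤ c⁻¹ * Real.exp (c * (z - 2 * η)) := by
    rw [le_inv_mul_iff₀ hc]
    linarith [Real.add_one_le_exp (c * (z - 2 * η))]
  have hexp0 : 0 ≤ c⁻¹ * Real.exp (c * (z - 2 * η)) := by positivity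
  rw [abs_le]
  constructor <;> linarith

/-- A bound on one exponential moment controls the upper tail of the average, and together with the
lower bound on the mean also the lower tail. -/
lemma mean_abs_average_sub_le (hw : ∀ σ ∈ C, 0 ≤ w σ) (h0 : 0 < ∑ σ ∈ C, w σ)
    (hY : ∀ i σ, |Y i σ| ≤ 1) (hM : |M| ≤ 1) (ha : 0 < a) (ha' : a ≤ 1 / 2) (haη : 2 * a ≤ η)
    (hT : 0 < T.card)
    (hprod : mean C w (fun σ => ∏ i ∈ T, (1 + a * Y i σ)) ≤ (1 + a * (M + η)) ^ T.card)
    (hmean : M - η ≤ mean C w fun σ => (T.card : ℝ)⁻¹ * ∑ i ∈ T, Y i σ) :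
    mean C w (fun σ => |(T.card : ℝ)⁻¹ * ∑ i ∈ T, Y i σ - M|) ≤ 5 * η + 2 * (a * T.card)⁻¹ := by
  have hN : (0 : ℝ) < T.card := Nat.cast_pos.2 hT
  set Z : X → ℝ := fun σ => (T.card : ℝ)⁻¹ * ∑ i ∈ T, Y i σ with hZ
  have hexp : mean C w (fun σ => Real.exp (a * T.card * (Z σ - M - 2 * η))) ≤ 1 := by
    refine le_of_eq_of_le (congrArg _ (funext fun σ => ?_))
      (mean_exp_le_one hw hY hM ha ha' haη hprod)
    rw [hZ]
    congr 1
    field_simp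
    ring
  have hpoint : ∀ σ, |Z σ - M| ≤ 4 * η + M +
      (2 * (a * T.card)⁻¹ * Real.exp (a * T.card * (Z σ - M - 2 * η)) + (-1) * Z σ) := fun σ => by
    linarith [abs_le_add_exp_sub (z := Z σ - M) (mul_pos ha hN) (by linarith : 0 ≤ η)]
  calc _ ≤ 4 * η + M + (2 * (a * T.card)⁻¹ *
          mean C w (fun σ => Real.exp (a * T.card * (Z σ - M - 2 * η))) + (-1) * mean C w Z) := by
        refine (mean_mono hw fun σ _ => hpoint σ).trans_eq ?_
        simp only [mean_add, mean_const h0, mean_const_mul]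
    _ ≤ 4 * η + M + (2 * (a * T.card)⁻¹ * 1 + (-1) * (M - η)) := by
        gcongr _ + (_ * ?_ + ?_)
        linarith
    _ = 5 * η + 2 * (a * T.card)⁻¹ := by ring

end Concentration

section Averages

variable {d : ℕ} {J : Sym2 (Site d) → ℝ} {β : ℝ} {s : ℤˣ} {h : Finset (Site d) → Site d → ℝ}
  {S : Finset (Edge (Site d))}

lemma tendsto_isingMean_average (hJ : IsSummableCoupling J) (hh : IsMonotoneField J s h)
    (hβ : 0 ≤ β) {T : Finset (Site d)} (hT : T.Nonempty) :
    Tendsto (fun L => isingMean J β (h (box d L)) (box d L)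
      fun σ => (T.card : ℝ)⁻¹ * ∑ y ∈ T, sgn s * bondProd (shiftEdges y S) σ) atTop
      (𝓝 (sgn s * limCorr J β h S)) := by
  have hcard : (T.card : ℝ) ≠ 0 := Nat.cast_ne_zero.2 hT.card_ne_zero
  have hsum := (tendsto_finsetSum T fun y _ =>
    (tendsto_isingMean_box hJ hh hβ S y).const_mul (sgn s)).const_mul (T.card : ℝ)⁻¹
  rw [Finset.sum_const, nsmul_eq_mul, inv_mul_cancel_left₀ hcard] at hsum
  simpa only [isingMean, mean_const_mul, mean_sum] using hsum

lemma abs_sgn_mul_sum_sub {ι : Type*} (T : Finset ι) (s : ℤˣ) (c M : ℝ) (u : ι → ℝ) :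
    |c * ∑ i ∈ T, sgn s * u i - sgn s * M| = |c * ∑ i ∈ T, u i - M| := by
  rw [← Finset.mul_sum, mul_left_comm, ← mul_sub, abs_mul, abs_sgn, one_mul]

theorem exists_isingMean_abs_average_sub_le (hJ : IsSummableCoupling J) (hh : IsMonotoneField J s h)
    (hβ : 0 < β) (hS : ∀ e ∈ S, 0 < J e.1) {ε : ℝ} (hε : 0 < ε) :
    ∃ N₀ : ℕ, ∀ T : Finset (Site d), N₀ ≤ T.card →
      (T : Set (Site d)).PairwiseDisjoint (fun y => shiftEdges y S) →
      ∀ᶠ L in atTop, isingMean J β (h (box d L)) (box d L)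
        (fun σ => |(T.card : ℝ)⁻¹ * ∑ y ∈ T, bondProd (shiftEdges y S) σ - limCorr J β h S|) ≤
          ε := by
  obtain ⟨a₀, ha₀, H⟩ := exists_isingMean_tilt_le hJ hh hβ hS
    (div_pos hε (by norm_num : 0 < (10 : ℝ)))
  obtain ⟨a, ha, ha'⟩ := exists_between (lt_min ha₀ (lt_min (by norm_num : (0 : ℝ) < 1 / 2)
    (div_pos hε (by norm_num : (0 : ℝ) < 20))))
  simp only [lt_min_iff] at ha'
  obtain ⟨N₀, hN₀⟩ := exists_nat_gt (4 / (a * ε))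
  have hN₀0 : (0 : ℝ) < N₀ := lt_of_le_of_lt (by positivity) hN₀
  refine ⟨N₀, fun T hT hd => ?_⟩
  have hTN : (N₀ : ℝ) ≤ T.card := Nat.cast_le.2 hT
  have hT0 : 0 < T.card := (Nat.cast_pos.1 hN₀0).trans_le hT
  have hmean := (tendsto_isingMean_average (S := S) hJ hh hβ.le (Finset.card_pos.1 hT0)).eventually
    (lt_mem_nhds (sub_lt_self _ (div_pos hε (by norm_num : (0 : ℝ) < 10))))
  filter_upwards [H a ha ha'.1.le T hd, hmean] with L htilt hmean
  have hprod : tilt (a * sgn s) (fun y => shiftEdges y S) T =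
      fun σ => ∏ y ∈ T, (1 + a * (sgn s * bondProd (shiftEdges y S) σ)) :=
    funext fun σ => Finset.prod_congr rfl fun y _ => by rw [mul_assoc]
  rw [hprod] at htilt
  have hconc := mean_abs_average_sub_le (fun σ _ => (isingWeight_pos σ).le) (sum_isingWeight_pos _)
    (fun y σ => by rw [abs_mul, abs_sgn, abs_bondProd, one_mul])
    (by rw [abs_mul, abs_sgn, one_mul]; exact abs_limCorr_le hh hβ.le) ha ha'.2.1.le
    (by linarith) hT0 htilt hmean.le
  have hcard : (a * T.card)⁻¹ ≤ ε / 4 := by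
    rw [inv_le_comm₀ (by positivity) (by positivity), inv_div, div_le_iff₀ hε]
    rw [div_lt_iff₀ (by positivity)] at hN₀
    nlinarith [mul_le_mul_of_nonneg_left hTN (mul_pos ha hε).le]
  simp only [abs_sgn_mul_sum_sub] at hconc
  exact hconc.trans (by linarith)

end Averages

/-! ### Averages over distant translates -/

section Translates

variable {d : ℕ} {J : Sym2 (Site d) → ℝ} {β : ℝ} {s : ℤˣ} {h : Finset (Site d) → Site d → ℝ}

lemma Edge.exists_mem {V : Type} (e : Edge V) : ∃ v, v ∈ e.1 := by
  obtain ⟨e, -⟩ := e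
  induction e using Sym2.ind with
  | _ x y => exact ⟨x, Sym2.mem_mk_left x y⟩

lemma disjoint_edgesIn {V : Type} {G G' : Finset V} (hG : Disjoint G G') :
    Disjoint (edgesIn G) (edgesIn G') := by
  refine Finset.disjoint_left.2 fun e he he' => ?_
  obtain ⟨v, hv⟩ := e.exists_mem
  exact Finset.disjoint_left.1 hG (mem_edgesIn.1 he v hv) (mem_edgesIn.1 he' v hv)

lemma exists_disjoint_shiftSites [Infinite (Site d)] (G : Finset (Site d)) (N : ℕ) :
    ∃ T : Finset (Site d), T.card = N ∧
      (T : Set (Site d)).PairwiseDisjoint fun y => shiftSites y G := by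
  induction N with
  | zero => exact ⟨∅, rfl, by simp⟩
  | succ N ih =>
    obtain ⟨T, hT, hd⟩ := ih
    obtain ⟨x, hx⟩ := Infinite.exists_notMem_finset
      (T ∪ ((G ×ˢ G) ×ˢ T).image fun p => p.1.1 + p.2 - p.1.2)
    simp only [Finset.mem_union, Finset.mem_image, Finset.mem_product, not_or] at hx
    refine ⟨insert x T, by rw [Finset.card_insert_of_notMem hx.1, hT], ?_⟩
    rw [Finset.coe_insert]
    refine hd.insert fun y hy _ => Finset.disjoint_left.2 fun v hvx hvy => hx.2 ?_
    exact ⟨((v - y, v - x), y), ⟨⟨mem_shiftSites.1 hvy, mem_shiftSites.1 hvx⟩, hy⟩, by simp⟩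

lemma exists_disjoint_shiftEdges [Infinite (Site d)] (E : Finset (Edge (Site d))) (N : ℕ) :
    ∃ T : Finset (Site d), T.card = N ∧
      (T : Set (Site d)).PairwiseDisjoint fun y => shiftEdges y E := by
  obtain ⟨G, hG⟩ := exists_subset_edgesIn E
  obtain ⟨T, hT, hd⟩ := exists_disjoint_shiftSites G N
  refine ⟨T, hT, fun x hx y hy hxy => ?_⟩
  have hdisj := disjoint_edgesIn (hd hx hy hxy)
  rw [← shiftEdges_edgesIn, ← shiftEdges_edgesIn] at hdisj
  exact hdisj.mono (shiftEdges_mono x hG) (shiftEdges_mono y hG)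

lemma exists_currentFactor_eq (a : ℝ) (k : ℕ) :
    ∃ p q : ℝ, (a = 0 → q = 0) ∧ ∀ u, currentFactor a k u = q * sgn u + p := by
  refine ⟨(currentFactor a k 1 + currentFactor a k (-1)) / 2,
    (currentFactor a k 1 - currentFactor a k (-1)) / 2, ?_, fun u => ?_⟩
  · rintro rfl
    rcases k with _ | k <;> simp [currentFactor]
  · rcases Int.units_eq_one_or u with rfl | rfl
    · rw [map_one]
      ring
    · rw [sgn_neg_one]
      ring

lemma exists_cylFun_eq (hJ : ∀ e, 0 ≤ J e) (β : ℝ) (E : Finset (Edge (Site d)))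
    (m : Current (Site d)) :
    ∃ c : Finset (Edge (Site d)) → ℝ, (∀ S, c S ≠ 0 → ∀ e ∈ S, 0 < J e.1) ∧
      cylFun J β E m = fun σ => ∑ S ∈ E.powerset, c S * bondProd S σ := by
  classical
  choose p q hq hpq using fun e : Edge (Site d) => exists_currentFactor_eq (β * J e.1) (m e)
  refine ⟨fun S => (∏ e ∈ S, q e) * ∏ e ∈ E \ S, p e, fun S hS e he => ?_, funext fun σ => ?_⟩
  · refine (hJ e.1).lt_of_ne' fun hJe => hS ?_
    exact mul_eq_zero_of_left (Finset.prod_eq_zero he (hq e (by rw [hJe, mul_zero]))) _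
  · simp only [cylFun, hpq, Finset.prod_add, Finset.prod_mul_distrib, bondProd]
    exact Finset.sum_congr rfl fun S _ => mul_right_comm _ _ _

lemma shift_neg_map {S : Type} (m : Edge (Site d) → S) (x : Site d) (e : Edge (Site d)) :
    shift (-x) m (e.map (Equiv.addRight x).toEmbedding) = m e := by
  rw [shift]
  conv_rhs => rw [← map_addRight_map_addRight_neg (-x) e, neg_neg]

lemma IsSummableCoupling.cylFun_shift (hJ : IsSummableCoupling J) (β : ℝ)
    (E : Finset (Edge (Site d))) (m : Current (Site d)) (x : Site d) :
    cylFun J β (shiftEdges x E) (shift (-x) m) = fun σ => cylFun J β E m (σ ∘ (· + x)) := by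
  funext σ
  simp only [cylFun, shiftEdges, Finset.prod_map, Function.Embedding.coeFn_mk]
  refine Finset.prod_congr rfl fun e _ => ?_
  have hJe : J (e.map (Equiv.addRight x).toEmbedding).1 = J e.1 := hJ.map_add x e.1
  rw [shift_neg_map, hJe, Edge.map, bond_map]
  rfl

lemma sq_sum_mul_le {ι : Type*} (A : Finset ι) (c : ι → ℝ) {u : ι → ℝ} {b : ℝ}
    (hu : ∀ i, |u i| ≤ b) :
    (∑ i ∈ A, c i * u i) ^ 2 ≤ b * (∑ i ∈ A, |c i|) * ∑ i ∈ A, |c i| * |u i| := by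
  have habs : |∑ i ∈ A, c i * u i| ≤ ∑ i ∈ A, |c i| * |u i| := by
    simpa only [abs_mul] using Finset.abs_sum_le_sum_abs (fun i => c i * u i) A
  have hbound : ∑ i ∈ A, |c i| * |u i| ≤ b * ∑ i ∈ A, |c i| := by
    rw [mul_comm, Finset.sum_mul]
    exact Finset.sum_le_sum fun i _ => mul_le_mul_of_nonneg_left (hu i) (abs_nonneg _)
  rw [← sq_abs, sq]
  exact mul_le_mul (habs.trans hbound) habs (abs_nonneg _)
    ((abs_nonneg _).trans (habs.trans hbound))

lemma abs_average_le_one {ι : Type*} (T : Finset ι) {f : ι → ℝ} (hf : ∀ i, |f i| ≤ 1) :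
    |(T.card : ℝ)⁻¹ * ∑ i ∈ T, f i| ≤ 1 := by
  rw [abs_mul, abs_inv, Nat.abs_cast]
  refine inv_mul_le_one_of_le₀ ((Finset.abs_sum_le_sum_abs _ _).trans ?_) (Nat.cast_nonneg _)
  exact (Finset.sum_le_card_nsmul _ _ 1 fun i _ => hf i).trans_eq (by simp)

lemma tendsto_isingMean_sum_bondProd (hJ : IsSummableCoupling J) (hh : IsMonotoneField J s h)
    (hβ : 0 ≤ β) (A : Finset (Finset (Edge (Site d)))) (c : Finset (Edge (Site d)) → ℝ)
    (x : Site d) :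
    Tendsto (fun L => isingMean J β (h (box d L)) (box d L)
      fun σ => ∑ S ∈ A, c S * bondProd (shiftEdges x S) σ) atTop
      (𝓝 (∑ S ∈ A, c S * limCorr J β h S)) := by
  simpa only [isingMean, mean_sum, mean_const_mul] using
    tendsto_finsetSum A fun S _ => (tendsto_isingMean_box hJ hh hβ S x).const_mul (c S)

lemma isingMean_sq_average_sub_le (hh : IsMonotoneField J s h) (hβ : 0 ≤ β) (G T : Finset (Site d))
    (A : Finset (Finset (Edge (Site d)))) (c : Finset (Edge (Site d)) → ℝ) :
    isingMean J β (h G) G (fun σ => ((T.card : ℝ)⁻¹ * ∑ y ∈ T, ∑ S ∈ A,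
        c S * bondProd (shiftEdges y S) σ - ∑ S ∈ A, c S * limCorr J β h S) ^ 2) ≤
      2 * (∑ S ∈ A, |c S|) * ∑ S ∈ A, |c S| * isingMean J β (h G) G (fun σ =>
        |(T.card : ℝ)⁻¹ * ∑ y ∈ T, bondProd (shiftEdges y S) σ - limCorr J β h S|) := by
  set u : Finset (Edge (Site d)) → (Site d → ℤˣ) → ℝ := fun S σ =>
    (T.card : ℝ)⁻¹ * ∑ y ∈ T, bondProd (shiftEdges y S) σ - limCorr J β h S with hu
  have hu2 : ∀ σ S, |u S σ| ≤ 2 := fun σ S => by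
    have haverage := abs_average_le_one T fun y => (abs_bondProd (shiftEdges y S) σ).le
    exact (abs_sub _ _).trans (by linarith [abs_limCorr_le (S := S) hh hβ])
  have hsum : ∀ σ, (T.card : ℝ)⁻¹ * ∑ y ∈ T, ∑ S ∈ A, c S * bondProd (shiftEdges y S) σ -
      ∑ S ∈ A, c S * limCorr J β h S = ∑ S ∈ A, c S * u S σ := by
    intro σ
    rw [Finset.sum_comm, Finset.mul_sum, ← Finset.sum_sub_distrib]
    refine Finset.sum_congr rfl fun S _ => ?_
    rw [hu, ← Finset.mul_sum]
    ring
  simp only [hsum]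
  refine (isingMean_mono fun σ => sq_sum_mul_le A c (hu2 σ)).trans_eq ?_
  simp only [isingMean, mean_const_mul, mean_sum, hu]

lemma exists_isingMean_sq_average_sub_le (hJ : IsSummableCoupling J) (hh : IsMonotoneField J s h)
    (hβ : 0 < β) (E : Finset (Edge (Site d))) {c : Finset (Edge (Site d)) → ℝ}
    (hc : ∀ S, c S ≠ 0 → ∀ e ∈ S, 0 < J e.1) {ε : ℝ} (hε : 0 < ε) :
    ∃ N₀ : ℕ, ∀ T : Finset (Site d), N₀ ≤ T.card →
      (T : Set (Site d)).PairwiseDisjoint (fun y => shiftEdges y E) →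
      ∀ᶠ L in atTop, isingMean J β (h (box d L)) (box d L) (fun σ =>
        ((T.card : ℝ)⁻¹ * ∑ y ∈ T, ∑ S ∈ E.powerset, c S * bondProd (shiftEdges y S) σ -
          ∑ S ∈ E.powerset, c S * limCorr J β h S) ^ 2) ≤ ε := by
  set B : ℝ := ∑ S ∈ E.powerset, |c S| with hB
  have : 0 ≤ B := Finset.sum_nonneg fun _ _ => abs_nonneg _
  obtain ⟨δ, hδ, hδε⟩ : ∃ δ > 0, 2 * B * (B * δ) ≤ ε := by
    refine ⟨ε / (2 * B * B + 1), by positivity, ?_⟩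
    rw [← mul_assoc, mul_div_assoc', div_le_iff₀ (by positivity)]
    linarith
  have hterm : ∀ S ∈ E.powerset, ∃ N₀ : ℕ, ∀ T : Finset (Site d), N₀ ≤ T.card →
      (T : Set (Site d)).PairwiseDisjoint (fun y => shiftEdges y E) →
      ∀ᶠ L in atTop, |c S| * isingMean J β (h (box d L)) (box d L)
        (fun σ => |(T.card : ℝ)⁻¹ * ∑ y ∈ T, bondProd (shiftEdges y S) σ - limCorr J β h S|) ≤
          |c S| * δ := by
    intro S hS
    by_cases hcS : c S = 0
    · exact ⟨0, fun T _ _ => by simp [hcS]⟩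
    · obtain ⟨N₀, hN₀⟩ := exists_isingMean_abs_average_sub_le hJ hh hβ (hc S hcS) hδ
      exact ⟨N₀, fun T hT hd => (hN₀ T hT
        (hd.mono fun y => shiftEdges_mono y (Finset.mem_powerset.1 hS))).mono fun L hL =>
          mul_le_mul_of_nonneg_left hL (abs_nonneg _)⟩
  choose! N₀ hN₀ using hterm
  refine ⟨E.powerset.sup N₀, fun T hT hd => ?_⟩
  filter_upwards [(eventually_all_finset E.powerset).2 fun S hS =>
    hN₀ S hS T ((Finset.le_sup hS).trans hT) hd] with L hL
  refine (isingMean_sq_average_sub_le hh hβ.le _ _ _ _).trans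
    ((mul_le_mul_of_nonneg_left ?_ (by positivity)).trans hδε)
  rw [hB, Finset.sum_mul]
  exact Finset.sum_le_sum hL

theorem exists_cylFun_limit (hJ : IsSummableCoupling J) (hh : IsMonotoneField J s h) (hβ : 0 < β)
    (E : Finset (Edge (Site d))) (m : Current (Site d)) :
    ∃ p : ℝ, (∀ x, Tendsto (fun L => isingMean J β (h (box d L)) (box d L)
        fun σ => cylFun J β E m (σ ∘ (· + x))) atTop (𝓝 p)) ∧
      ∀ ε > 0, ∃ N₀ : ℕ, ∀ T : Finset (Site d), N₀ ≤ T.card →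
        (T : Set (Site d)).PairwiseDisjoint (fun y => shiftEdges y E) →
        ∀ᶠ L in atTop, isingMean J β (h (box d L)) (box d L)
          (fun σ => ((T.card : ℝ)⁻¹ * ∑ y ∈ T, cylFun J β E m (σ ∘ (· + y)) - p) ^ 2) ≤ ε := by
  obtain ⟨c, hc, hF⟩ := exists_cylFun_eq hJ.nonneg β E m
  have hshift : ∀ (x : Site d) (σ : Site d → ℤˣ), cylFun J β E m (σ ∘ (· + x)) =
      ∑ S ∈ E.powerset, c S * bondProd (shiftEdges x S) σ := fun x σ => by
    simp only [hF, bondProd_shiftEdges]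
  simp only [hshift]
  exact ⟨_, tendsto_isingMean_sum_bondProd hJ hh hβ.le E.powerset c, fun ε hε =>
    exists_isingMean_sq_average_sub_le hJ hh hβ E hc hε⟩

end Translates

/-! ### Cylinder events -/

section Cylinders

variable {d : ℕ} {I S : Type*}

lemma shift_preimage_cyl {S : Type} (x : Site d) (E : Finset (Edge (Site d)))
    (m : Edge (Site d) → S) : shift x ⁻¹' cyl E m = cyl (shiftEdges x E) (shift (-x) m) := by
  ext ω
  simp only [cyl, shiftEdges, Set.mem_preimage, Set.mem_ofPred_eq, Finset.forall_mem_map,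
    Function.Embedding.coeFn_mk, shift_neg_map]
  rfl

lemma measurable_shift {S : Type} [MeasurableSpace S] (x : Site d) :
    Measurable (shift x : (Edge (Site d) → S) → _) :=
  measurable_pi_lambda _ fun _ => measurable_pi_apply _

lemma cyl_inter_eq [DecidableEq I] {E E' : Finset I} {m m' ω : I → S}
    (hω : ω ∈ cyl E m ∩ cyl E' m') : cyl E m ∩ cyl E' m' = cyl (E ∪ E') ω := by
  have hE : cyl E m = cyl E ω := Set.ext fun ω' => forall₂_congr fun e he => by rw [hω.1 e he]
  have hE' : cyl E' m' = cyl E' ω := Set.ext fun ω' => forall₂_congr fun e he => by rw [hω.2 e he]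
  rw [hE, hE']
  exact Set.ext fun ω' => Finset.forall_mem_union.symm

/-- The cylinder events of `I → S`, which generate the product `σ`-algebra. -/
def cylinders (I S : Type*) : Set (Set (I → S)) := {A | ∃ E m, A = cyl E m}

lemma isPiSystem_cylinders : IsPiSystem (cylinders I S) := by
  classical
  rintro _ ⟨E, m, rfl⟩ _ ⟨E', m', rfl⟩ ⟨ω, hω⟩
  exact ⟨_, _, cyl_inter_eq hω⟩

variable [MeasurableSpace S] [MeasurableSingletonClass S] [Countable S]

lemma generateFrom_cylinders :
    (MeasurableSpace.pi : MeasurableSpace (I → S)) =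
      MeasurableSpace.generateFrom (cylinders I S) := by
  apply le_antisymm
  · refine iSup_le fun e => Measurable.comap_le ?_
    refine @measurable_to_countable' _ _ _ _ (MeasurableSpace.generateFrom (cylinders I S)) _
      fun k => MeasurableSpace.measurableSet_generateFrom ⟨{e}, fun _ => k, ?_⟩
    ext ω
    simp [cyl]
  · refine MeasurableSpace.generateFrom_le ?_
    rintro _ ⟨E, m, rfl⟩
    exact measurableSet_cyl E m

lemma measure_eq_of_cyl {μ μ' : Measure (I → S)} [IsProbabilityMeasure μ]
    [IsProbabilityMeasure μ'] (h : ∀ E m, μ.real (cyl E m) = μ'.real (cyl E m)) : μ = μ' := by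
  refine ext_of_generate_finite _ generateFrom_cylinders isPiSystem_cylinders ?_ (by simp)
  rintro _ ⟨E, m, rfl⟩
  exact (measureReal_eq_measureReal_iff).1 (h E m)

lemma eventuallyConst_of_indep_cyl {μ : Measure (I → S)} [IsProbabilityMeasure μ] {A : Set (I → S)}
    (hA : MeasurableSet A) (h : ∀ E m, μ.real (A ∩ cyl E m) = μ.real A * μ.real (cyl E m)) :
    EventuallyConst A (ae μ) := by
  have hrestrict : μ.restrict A = μ A • μ := by
    refine ext_of_generate_finite _ generateFrom_cylinders isPiSystem_cylinders ?_ (by simp)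
    rintro _ ⟨E, m, rfl⟩
    rw [Measure.restrict_apply (measurableSet_cyl E m), Set.inter_comm, Measure.smul_apply,
      smul_eq_mul, ← ENNReal.toReal_eq_toReal_iff' (measure_ne_top _ _)
      (ENNReal.mul_ne_top (measure_ne_top _ _) (measure_ne_top _ _)), ENNReal.toReal_mul]
    exact h E m
  have hself : μ A = μ A * μ A := by
    simpa only [Measure.restrict_apply hA, Set.inter_self, Measure.smul_apply, smul_eq_mul] using
      congrArg (fun ρ => ρ A) hrestrict
  rw [eventuallyConst_set', ae_eq_empty, ae_eq_univ, prob_compl_eq_zero_iff hA]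
  exact (eq_or_ne (μ A) 0).imp_right fun hne =>
    ((ENNReal.mul_eq_left hne (measure_ne_top μ A)).1 hself.symm)

end Cylinders

section DependsOn

variable {I S : Type*}

lemma isClopen_of_dependsOn [TopologicalSpace S] [DiscreteTopology S] {E : Finset I}
    {A : Set (I → S)} (hA : DependsOn (fun ω => ω ∈ A) (E : Set I)) : IsClopen A := by
  have hpre : A = E.restrict ⁻¹' (E.restrict '' A) := by
    refine (Set.subset_preimage_image _ _).antisymm ?_
    rintro ω ⟨ω', hω', heq⟩
    exact (hA fun e he => congrFun heq ⟨e, he⟩).mp hω'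
  rw [hpre]
  exact (isClopen_discrete _).preimage (Finset.continuous_restrict E)

lemma dependsOn_cyl (E : Finset I) (m : I → S) :
    DependsOn (fun ω => ω ∈ cyl E m) (E : Set I) := fun ω ω' hω =>
  propext (forall₂_congr fun e he => by rw [hω e he])

lemma dependsOn_inter {E E' : Set I} {A A' : Set (I → S)} (hA : DependsOn (fun ω => ω ∈ A) E)
    (hA' : DependsOn (fun ω => ω ∈ A') E') : DependsOn (fun ω => ω ∈ A ∩ A') (E ∪ E') :=
  fun _ _ hω => congrArg₂ And (hA fun e he => hω e (Or.inl he)) (hA' fun e he => hω e (Or.inr he))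

end DependsOn

/-! ### The infinite volume limit -/

section Limit

variable {d : ℕ} {J : Sym2 (Site d) → ℝ} {β : ℝ}

lemma abs_currentFactor_le (a : ℝ) (k : ℕ) (u : ℤˣ) :
    |currentFactor a k u| ≤ |a| ^ k / k ! * Real.exp |a| := by
  rw [currentFactor, abs_mul, abs_mul, abs_pow (sgn u), abs_sgn, one_pow, mul_one, abs_div, abs_pow,
    Nat.abs_cast, Real.abs_exp]
  refine mul_le_mul_of_nonneg_left (Real.exp_le_exp.2 ?_) (by positivity)
  calc -(a * sgn u) ≤ |-(a * sgn u)| := le_abs_self _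
    _ = |a| := by rw [abs_neg, abs_mul, abs_sgn, mul_one]

lemma IsCurrentLaw.real_eq_le {h : Site d → ℝ} {G : Finset (Site d)}
    {ν : Measure (Current (Site d))} (hν : IsCurrentLaw J β h G ν) (e : Edge (Site d)) {k : ℕ}
    (hk : k ≠ 0) : ν.real {ω | ω e = k} ≤ |β * J e.1| ^ k / k ! * Real.exp |β * J e.1| := by
  by_cases he : e ∈ edgesIn G
  · have hcyl : {ω : Current (Site d) | ω e = k} = cyl {e} fun _ => k := by
      ext
      simp [cyl]
    rw [hcyl, hν.real_cyl _ _ (Finset.singleton_subset_iff.2 he)]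
    refine (le_abs_self _).trans (abs_isingMean_le fun σ => ?_)
    rw [cylFun, Finset.prod_singleton]
    exact abs_currentFactor_le _ _ _
  · have hnull : ν {ω | ω e = k} = 0 :=
      measure_mono_null (fun ω (hω : ω e = k) => hω.trans_ne hk) (hν.support e he)
    rw [Measure.real, hnull, ENNReal.toReal_zero]
    positivity

lemma exists_tail_bound (J : Sym2 (Site d) → ℝ) (β : ℝ) (e : Edge (Site d)) {ε : ENNReal}
    (hε : 0 < ε) :
    ∃ N : ℕ, ∀ (h : Site d → ℝ) (G : Finset (Site d)) (ν : Measure (Current (Site d))),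
      IsCurrentLaw J β h G ν → ν {ω | N ≤ ω e} ≤ ε := by
  set f : ℕ → ENNReal := fun k =>
    ENNReal.ofReal (|β * J e.1| ^ k / k ! * Real.exp |β * J e.1|) with hf
  have hsum : ∑' k, f k ≠ ⊤ := by
    rw [hf, ← ENNReal.ofReal_tsum_of_nonneg (fun k => by positivity)
      ((hasSum_pow_div_factorial _).summable.mul_right _)]
    exact ENNReal.ofReal_ne_top
  have htail := (ENNReal.tendsto_sum_nat_add f hsum).eventually (gt_mem_nhds hε)
  obtain ⟨N, hN, hN1⟩ := (htail.and (eventually_ge_atTop 1)).exists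
  refine ⟨N, fun h G ν hν => ?_⟩
  have := hν.isProbability
  have hunion : {ω : Current (Site d) | N ≤ ω e} = ⋃ k : ℕ, {ω | ω e = k + N} := by
    ext ω
    simp only [Set.mem_ofPred_eq, Set.mem_iUnion]
    exact ⟨fun h => ⟨ω e - N, by omega⟩, fun ⟨k, hk⟩ => by omega⟩
  rw [hunion]
  refine (measure_iUnion_le _).trans (le_trans (ENNReal.tsum_le_tsum fun k => ?_) hN.le)
  exact (ENNReal.le_ofReal_iff_toReal_le (measure_ne_top _ _) (by positivity)).2
    (hν.real_eq_le e (by omega))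

lemma isTightMeasureSet_currentLaw {M : Set (Measure (Current (Site d)))}
    (hM : ∀ ν ∈ M, ∃ h G, IsCurrentLaw J β h G ν) : IsTightMeasureSet M := by
  rw [isTightMeasureSet_iff_exists_isCompact_measure_compl_le]
  intro ε hε
  obtain ⟨δ, hδ0, hδ⟩ := ENNReal.exists_pos_sum_of_countable hε.ne' (Edge (Site d))
  choose N hN using fun e => exists_tail_bound J β e (ENNReal.coe_pos.2 (hδ0 e))
  refine ⟨Set.pi Set.univ fun e => Set.Iio (N e),
    isCompact_univ_pi fun e => (Set.finite_Iio _).isCompact, fun ν hν => ?_⟩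
  obtain ⟨h, G, hlaw⟩ := hM ν hν
  have hcompl : (Set.pi Set.univ fun e => Set.Iio (N e))ᶜ =
      ⋃ e, {ω : Current (Site d) | N e ≤ ω e} := by
    ext ω
    simp [Set.mem_pi]
  rw [hcompl]
  exact (measure_iUnion_le _).trans
    ((ENNReal.tsum_le_tsum fun e => hN e h G ν hlaw).trans hδ.le)

/-- Local convergence of laws: convergence on the events that depend on finitely many
coordinates. -/
def TendstoLocally {I S : Type*} [MeasurableSpace S] (ν : ℕ → Measure (I → S))
    (μ : Measure (I → S)) : Prop :=
  ∀ (E : Finset I) (A : Set (I → S)), DependsOn (fun ω => ω ∈ A) (E : Set I) →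
    Tendsto (fun L => ν L A) atTop (𝓝 (μ A))

theorem exists_limit_of_tendsto_cyl {I : Type*} [Countable I] {ν : ℕ → Measure (I → ℕ)}
    (hprob : ∀ L, IsProbabilityMeasure (ν L)) (htight : IsTightMeasureSet (Set.range ν))
    (hlim : ∀ E m, ∃ q, Tendsto (fun L => (ν L).real (cyl E m)) atTop (𝓝 q)) :
    ∃ μ : Measure (I → ℕ), IsProbabilityMeasure μ ∧ TendstoLocally ν μ := by
  let ν' : ℕ → ProbabilityMeasure (I → ℕ) := fun L => ⟨ν L, hprob L⟩
  have hcomp : IsCompact (closure (Set.range ν')) :=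
    isCompact_closure_of_isTightMeasureSet
      (htight.subset (by rintro _ ⟨_, ⟨L, rfl⟩, rfl⟩; exact Set.mem_range_self L))
  have hmem : ∀ᶠ L in atTop, ν' L ∈ closure (Set.range ν') :=
    Eventually.of_forall fun L => subset_closure ⟨L, rfl⟩
  have hclopen : ∀ (E : Finset I) (A : Set (I → ℕ)), DependsOn (fun ω => ω ∈ A) (E : Set I) →
      ∀ (l : Filter ℕ) (μ : ProbabilityMeasure (I → ℕ)), Tendsto ν' l (𝓝 μ) →
        Tendsto (fun L => ν L A) l (𝓝 ((μ : Measure (I → ℕ)) A)) :=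
    fun E A hA l μ hμ => ProbabilityMeasure.tendsto_measure_of_null_frontier_of_tendsto' hμ
      (by rw [(isClopen_of_dependsOn hA).frontier_eq, measure_empty])
  have hcluster : ∀ μ, MapClusterPt μ atTop ν' → ∀ E m q,
      Tendsto (fun L => (ν L).real (cyl E m)) atTop (𝓝 q) →
        (μ : Measure (I → ℕ)).real (cyl E m) = q := fun μ hμ E m q hq => by
    obtain ⟨U, hU, hUμ⟩ := mapClusterPt_iff_ultrafilter.1 hμ
    exact tendsto_nhds_unique ((ENNReal.tendsto_toReal (measure_ne_top _ _)).comp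
      (hclopen E _ (dependsOn_cyl E m) _ _ hUμ)) (hq.mono_left hU)
  obtain ⟨μ, -, hμ⟩ := hcomp.exists_mapClusterPt_of_frequently hmem.frequently
  have huniq : ∀ μ' ∈ closure (Set.range ν'), MapClusterPt μ' atTop ν' → μ' = μ := by
    intro μ' _ hμ'
    refine Subtype.ext (measure_eq_of_cyl (μ := (μ' : Measure (I → ℕ))) (μ' := μ) fun E m => ?_)
    obtain ⟨q, hq⟩ := hlim E m
    exact (hcluster μ' hμ' E m q hq).trans (hcluster μ hμ E m q hq).symm
  exact ⟨μ, inferInstance, fun E A hA =>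
    hclopen E A hA _ _ (hcomp.tendsto_nhds_of_unique_mapClusterPt hmem huniq)⟩

end Limit

/-! ### Ergodicity -/

section Average

lemma sq_average_sub {ι : Type*} (T : Finset ι) (f : ι → ℝ) (c p : ℝ) :
    (c * ∑ y ∈ T, f y - p) ^ 2 =
      c ^ 2 * ∑ y ∈ T, ∑ z ∈ T, f y * f z + -(2 * p * c) * ∑ y ∈ T, f y + p ^ 2 := by
  rw [← Finset.sum_mul_sum]
  ring

lemma isingMean_sq_average {d : ℕ} {J : Sym2 (Site d) → ℝ} {β : ℝ} {h : Site d → ℝ}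
    {G : Finset (Site d)} {ι : Type*} (T : Finset ι) (F : ι → (Site d → ℤˣ) → ℝ) (c p : ℝ) :
    isingMean J β h G (fun σ => (c * ∑ y ∈ T, F y σ - p) ^ 2) =
      c ^ 2 * ∑ y ∈ T, ∑ z ∈ T, isingMean J β h G (fun σ => F y σ * F z σ) +
        -(2 * p * c) * ∑ y ∈ T, isingMean J β h G (F y) + p ^ 2 := by
  simp only [sq_average_sub, isingMean, mean_add, mean_const_mul, mean_sum,
    mean_const (sum_isingWeight_pos G)]

variable {Ω ι : Type*} [MeasurableSpace Ω] {μ : Measure Ω}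

lemma integrable_indicator_one [IsFiniteMeasure μ] {A : Set Ω} (hA : MeasurableSet A) :
    Integrable (A.indicator (1 : Ω → ℝ)) μ :=
  (integrable_const 1).indicator hA

lemma integral_sum_indicator_one [IsFiniteMeasure μ] (T : Finset ι) {B : ι → Set Ω}
    (hB : ∀ y, MeasurableSet (B y)) :
    ∫ ω, ∑ y ∈ T, (B y).indicator (1 : Ω → ℝ) ω ∂μ = ∑ y ∈ T, μ.real (B y) := by
  rw [integral_finsetSum T fun y _ => integrable_indicator_one (hB y)]
  exact Finset.sum_congr rfl fun y _ => integral_indicator_one (hB y)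

variable {B : ι → Set Ω}

lemma integral_sq_average_indicator [IsProbabilityMeasure μ] (T : Finset ι)
    (hB : ∀ y, MeasurableSet (B y)) (c p : ℝ) :
    ∫ ω, (c * ∑ y ∈ T, (B y).indicator 1 ω - p) ^ 2 ∂μ =
      c ^ 2 * ∑ y ∈ T, ∑ z ∈ T, μ.real (B y ∩ B z) + -(2 * p * c) * ∑ y ∈ T, μ.real (B y) +
        p ^ 2 := by
  have hmul : ∀ y z ω, (B y).indicator (1 : Ω → ℝ) ω * (B z).indicator 1 ω =
      (B y ∩ B z).indicator 1 ω := fun y z ω =>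
    (congrFun (Set.inter_indicator_one (s := B y) (t := B z)) ω).symm
  have hBB : ∀ i : ι × ι, MeasurableSet (B i.1 ∩ B i.2) := fun i => (hB i.1).inter (hB i.2)
  have hpairs : Integrable (fun ω => c ^ 2 *
      ∑ i ∈ T ×ˢ T, (B i.1 ∩ B i.2).indicator (1 : Ω → ℝ) ω) μ :=
    (integrable_finsetSum _ fun i _ => integrable_indicator_one (hBB i)).const_mul _
  have hsingle : Integrable (fun ω => -(2 * p * c) * ∑ y ∈ T, (B y).indicator (1 : Ω → ℝ) ω) μ :=
    (integrable_finsetSum _ fun y _ => integrable_indicator_one (hB y)).const_mul _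
  simp only [sq_average_sub, hmul, ← Finset.sum_product']
  rw [integral_add (show Integrable (fun ω => _ + _) μ from hpairs.add hsingle)
      (integrable_const _), integral_add hpairs hsingle, integral_const_mul, integral_const_mul,
    integral_sum_indicator_one _ hBB, integral_sum_indicator_one T hB, integral_const,
    probReal_univ, one_smul]

lemma memLp_average_indicator_sub [IsFiniteMeasure μ] (T : Finset ι)
    (hB : ∀ y, MeasurableSet (B y)) (c p : ℝ) :
    MemLp (fun ω => c * ∑ y ∈ T, (B y).indicator 1 ω - p) 2 μ :=
  ((memLp_finsetSum T fun y _ => (memLp_const (1 : ℝ)).indicator (hB y)).const_mul c).sub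
    (memLp_const p)

lemma setIntegral_average_indicator_sub [IsFiniteMeasure μ] (T : Finset ι)
    (hB : ∀ y, MeasurableSet (B y)) (A : Set Ω) (c p : ℝ) :
    ∫ ω in A, (c * ∑ y ∈ T, (B y).indicator 1 ω - p) ∂μ =
      c * ∑ y ∈ T, μ.real (B y ∩ A) - p * μ.real A := by
  rw [integral_sub ((integrable_finsetSum _ fun y _ => integrable_indicator_one (hB y)).const_mul _)
      (integrable_const _), integral_const_mul, integral_sum_indicator_one T hB, setIntegral_const,
    smul_eq_mul, mul_comm (μ.real A)]
  simp only [measureReal_restrict_apply (hB _)]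

lemma abs_setIntegral_le_of_integral_sq_le [IsProbabilityMeasure μ] {g : Ω → ℝ}
    (hg : MemLp g 2 μ) {ε : ℝ} (hε : 0 < ε) (hsq : ∫ ω, g ω ^ 2 ∂μ ≤ ε ^ 2) (A : Set Ω) :
    |∫ ω in A, g ω ∂μ| ≤ ε := by
  have hint : Integrable g μ := hg.integrable one_le_two
  have hamgm : ∀ ω, |g ω| ≤ (2 * ε)⁻¹ * g ω ^ 2 + ε / 2 := fun ω => by
    rw [← sub_nonneg]
    calc 0 ≤ (2 * ε)⁻¹ * (|g ω| - ε) ^ 2 := by positivity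
      _ = (2 * ε)⁻¹ * |g ω| ^ 2 + ε / 2 - |g ω| := by field_simp; ring
      _ = (2 * ε)⁻¹ * g ω ^ 2 + ε / 2 - |g ω| := by rw [sq_abs]
  calc |∫ ω in A, g ω ∂μ| ≤ ∫ ω in A, |g ω| ∂μ := abs_integral_le_integral_abs
    _ ≤ ∫ ω, |g ω| ∂μ :=
        setIntegral_le_integral hint.abs (Eventually.of_forall fun ω => abs_nonneg (g ω))
    _ ≤ ∫ ω, ((2 * ε)⁻¹ * g ω ^ 2 + ε / 2) ∂μ :=
        integral_mono hint.abs ((hg.integrable_sq.const_mul _).add (integrable_const _)) hamgm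
    _ = (2 * ε)⁻¹ * ∫ ω, g ω ^ 2 ∂μ + ε / 2 := by
        rw [integral_add (hg.integrable_sq.const_mul _) (integrable_const _), integral_const_mul,
          integral_const, probReal_univ, one_smul]
    _ ≤ (2 * ε)⁻¹ * ε ^ 2 + ε / 2 := by gcongr
    _ = ε := by field_simp; ring

end Average

section Ergodic

variable {d : ℕ} {J : Sym2 (Site d) → ℝ} {β : ℝ}

lemma shift_zero {S : Type} (ω : Edge (Site d) → S) : shift 0 ω = ω := by
  funext e
  exact congrArg ω (Subtype.ext (by simp [Edge.map]))

lemma infinite_site (e : Edge (Site d)) : Infinite (Site d) := by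
  rcases d with _ | d
  · obtain ⟨e, he⟩ := e
    induction e using Sym2.ind with
    | _ x y => exact absurd (Subsingleton.elim x y) (by rwa [Sym2.mk_isDiag_iff] at he)
  · infer_instance

section Box

variable {h : Site d → ℝ} {G : Finset (Site d)} {ν : Measure (Current (Site d))}

lemma IsCurrentLaw.real_shift_preimage_cyl (hν : IsCurrentLaw J β h G ν)
    (hJ : IsSummableCoupling J) {E : Finset (Edge (Site d))} (m : Current (Site d)) {x : Site d}
    (hE : shiftEdges x E ⊆ edgesIn G) :
    ν.real (shift x ⁻¹' cyl E m) =
      isingMean J β h G fun σ => cylFun J β E m (σ ∘ (· + x)) := by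
  rw [shift_preimage_cyl, hν.real_cyl _ _ hE, hJ.cylFun_shift]

lemma IsCurrentLaw.real_inter_shift_preimage_cyl (hν : IsCurrentLaw J β h G ν)
    (hJ : IsSummableCoupling J) {E : Finset (Edge (Site d))} (m : Current (Site d)) {x y : Site d}
    (hxy : Disjoint (shiftEdges x E) (shiftEdges y E)) (hx : shiftEdges x E ⊆ edgesIn G)
    (hy : shiftEdges y E ⊆ edgesIn G) :
    ν.real (shift x ⁻¹' cyl E m ∩ shift y ⁻¹' cyl E m) =
      isingMean J β h G
        fun σ => cylFun J β E m (σ ∘ (· + x)) * cylFun J β E m (σ ∘ (· + y)) := by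
  classical
  let m' : Current (Site d) := (shiftEdges x E).piecewise (shift (-x) m) (shift (-y) m)
  have hm'x : ∀ e ∈ shiftEdges x E, m' e = shift (-x) m e := fun e he =>
    Finset.piecewise_eq_of_mem _ _ _ he
  have hm'y : ∀ e ∈ shiftEdges y E, m' e = shift (-y) m e := fun e he =>
    Finset.piecewise_eq_of_notMem _ _ _ (Finset.disjoint_right.1 hxy he)
  rw [shift_preimage_cyl, shift_preimage_cyl, cyl_inter_eq (ω := m') ⟨hm'x, hm'y⟩,
    hν.real_cyl _ _ (Finset.union_subset hx hy)]
  congr 1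
  funext σ
  rw [← congrFun (hJ.cylFun_shift β E m x) σ, ← congrFun (hJ.cylFun_shift β E m y) σ, cylFun,
    cylFun, cylFun, Finset.prod_union hxy]
  congr 1
  · exact Finset.prod_congr rfl fun e he => by rw [hm'x e he]
  · exact Finset.prod_congr rfl fun e he => by rw [hm'y e he]

lemma IsCurrentLaw.sum_real_inter_shift_le (hν : IsCurrentLaw J β h G ν)
    (hJ : IsSummableCoupling J) {E : Finset (Edge (Site d))} (m : Current (Site d))
    {T : Finset (Site d)} (hT : (T : Set (Site d)).PairwiseDisjoint fun y => shiftEdges y E)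
    (hE : ∀ y ∈ T, shiftEdges y E ⊆ edgesIn G) :
    ∑ y ∈ T, ∑ z ∈ T, ν.real (shift y ⁻¹' cyl E m ∩ shift z ⁻¹' cyl E m) ≤
      T.card + ∑ y ∈ T, ∑ z ∈ T, isingMean J β h G
        fun σ => cylFun J β E m (σ ∘ (· + y)) * cylFun J β E m (σ ∘ (· + z)) := by
  classical
  have := hν.isProbability
  have hpair : ∀ y ∈ T, ∀ z ∈ T, ν.real (shift y ⁻¹' cyl E m ∩ shift z ⁻¹' cyl E m) ≤
      (if y = z then 1 else 0) + isingMean J β h G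
        fun σ => cylFun J β E m (σ ∘ (· + y)) * cylFun J β E m (σ ∘ (· + z)) := by
    intro y hy z hz
    by_cases hyz : y = z
    · subst hyz
      have hsq : 0 ≤ isingMean J β h G
          fun σ => cylFun J β E m (σ ∘ (· + y)) * cylFun J β E m (σ ∘ (· + y)) :=
        (isingMean_const 0).ge.trans (isingMean_mono fun σ => mul_self_nonneg _)
      rw [if_pos rfl]
      exact measureReal_le_one.trans (le_add_of_nonneg_right hsq)
    · rw [if_neg hyz, zero_add]
      exact (hν.real_inter_shift_preimage_cyl hJ m (hT hy hz hyz) (hE y hy) (hE z hz)).le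
  refine (Finset.sum_le_sum fun y hy => Finset.sum_le_sum fun z hz => hpair y hy z hz).trans_eq ?_
  simp [Finset.sum_add_distrib]

lemma IsCurrentLaw.integral_sq_average_le (hν : IsCurrentLaw J β h G ν)
    (hJ : IsSummableCoupling J) {E : Finset (Edge (Site d))} (m : Current (Site d))
    {T : Finset (Site d)} (hT : (T : Set (Site d)).PairwiseDisjoint fun y => shiftEdges y E)
    (hE : ∀ y ∈ T, shiftEdges y E ⊆ edgesIn G) (p : ℝ) :
    ∫ ω, ((T.card : ℝ)⁻¹ * ∑ y ∈ T, (shift y ⁻¹' cyl E m).indicator 1 ω - p) ^ 2 ∂ν ≤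
      isingMean J β h G
        (fun σ => ((T.card : ℝ)⁻¹ * ∑ y ∈ T, cylFun J β E m (σ ∘ (· + y)) - p) ^ 2) +
          (T.card : ℝ)⁻¹ := by
  have := hν.isProbability
  rw [integral_sq_average_indicator T fun y => measurable_shift y (measurableSet_cyl E m),
    isingMean_sq_average,
    Finset.sum_congr rfl fun y hy => hν.real_shift_preimage_cyl hJ m (hE y hy)]
  have hdiag : (T.card : ℝ)⁻¹ ^ 2 * T.card = (T.card : ℝ)⁻¹ := by
    rcases eq_or_ne (T.card : ℝ) 0 with h0 | h0
    · simp [h0]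
    · field_simp
  have hpairs := mul_le_mul_of_nonneg_left (hν.sum_real_inter_shift_le hJ m hT hE)
    (sq_nonneg (T.card : ℝ)⁻¹)
  rw [mul_add, hdiag] at hpairs
  linarith

end Box

variable {s : ℤˣ} {h : Finset (Site d) → Site d → ℝ} {ν : ℕ → Measure (Current (Site d))}
  {μ : Measure (Current (Site d))}

lemma TendstoLocally.tendsto_real {I S : Type*} [MeasurableSpace S] {ν : ℕ → Measure (I → S)}
    {μ : Measure (I → S)} [IsFiniteMeasure μ] (hμ : TendstoLocally ν μ) {E : Finset I}
    {A : Set (I → S)} (hA : DependsOn (fun ω => ω ∈ A) (E : Set I)) :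
    Tendsto (fun L => (ν L).real A) atTop (𝓝 (μ.real A)) :=
  (ENNReal.tendsto_toReal (measure_ne_top μ A)).comp (hμ E A hA)

lemma dependsOn_shift_preimage_cyl {S : Type} (x : Site d) (E : Finset (Edge (Site d)))
    (m : Edge (Site d) → S) :
    DependsOn (fun ω => ω ∈ shift x ⁻¹' cyl E m) (shiftEdges x E : Set (Edge (Site d))) := by
  rw [shift_preimage_cyl]
  exact dependsOn_cyl _ _

lemma TendstoLocally.tendsto_integral_sq_average [∀ L, IsProbabilityMeasure (ν L)]
    [IsProbabilityMeasure μ] (hμ : TendstoLocally ν μ) (T : Finset (Site d))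
    (E : Finset (Edge (Site d))) (m : Current (Site d)) (c p : ℝ) :
    Tendsto (fun L => ∫ ω, (c * ∑ y ∈ T, (shift y ⁻¹' cyl E m).indicator 1 ω - p) ^ 2 ∂ν L) atTop
      (𝓝 (∫ ω, (c * ∑ y ∈ T, (shift y ⁻¹' cyl E m).indicator 1 ω - p) ^ 2 ∂μ)) := by
  classical
  simp only [integral_sq_average_indicator T fun y => measurable_shift y (measurableSet_cyl E m)]
  refine (((tendsto_finsetSum T fun y _ => tendsto_finsetSum T fun z _ =>
    hμ.tendsto_real (E := shiftEdges y E ∪ shiftEdges z E) ?_).const_mul _).add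
      ((tendsto_finsetSum T fun y _ =>
        hμ.tendsto_real (dependsOn_shift_preimage_cyl y E m)).const_mul _)).add_const _
  rw [Finset.coe_union]
  exact dependsOn_inter (dependsOn_shift_preimage_cyl y E m) (dependsOn_shift_preimage_cyl z E m)

lemma exists_integral_sq_average_le [Infinite (Site d)] [IsProbabilityMeasure μ]
    (hJ : IsSummableCoupling J) (hν : ∀ L, IsCurrentLaw J β (h (box d L)) (box d L) (ν L))
    (hμ : TendstoLocally ν μ) {E : Finset (Edge (Site d))} {m : Current (Site d)} {p : ℝ}
    (hconc : ∀ ε > 0, ∃ N₀ : ℕ, ∀ T : Finset (Site d), N₀ ≤ T.card →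
        (T : Set (Site d)).PairwiseDisjoint (fun y => shiftEdges y E) →
        ∀ᶠ L in atTop, isingMean J β (h (box d L)) (box d L)
          (fun σ => ((T.card : ℝ)⁻¹ * ∑ y ∈ T, cylFun J β E m (σ ∘ (· + y)) - p) ^ 2) ≤ ε)
    {ε : ℝ} (hε : 0 < ε) :
    ∃ T : Finset (Site d), T.Nonempty ∧
      ∫ ω, ((T.card : ℝ)⁻¹ * ∑ y ∈ T, (shift y ⁻¹' cyl E m).indicator 1 ω - p) ^ 2 ∂μ ≤ ε := by
  have := fun L => (hν L).isProbability
  obtain ⟨N₀, hN₀⟩ := hconc (ε / 2) (half_pos hε)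
  obtain ⟨N₁, hN₁⟩ := exists_nat_gt (ε / 2)⁻¹
  obtain ⟨T, hT, hdisj⟩ := exists_disjoint_shiftEdges E (N₀ + N₁)
  have hN₁0 : 0 < N₁ := by exact_mod_cast (inv_pos.2 (half_pos hε)).trans hN₁
  have hcard : (T.card : ℝ)⁻¹ ≤ ε / 2 := by
    refine inv_le_of_inv_le₀ (half_pos hε) (hN₁.le.trans ?_)
    rw [hT]
    exact_mod_cast Nat.le_add_left _ _
  refine ⟨T, Finset.card_pos.1 (by omega),
    le_of_tendsto (hμ.tendsto_integral_sq_average T E m _ p) ?_⟩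
  filter_upwards [hN₀ T (by omega) hdisj, (eventually_all_finset T).2 fun y _ =>
    (tendsto_box d).eventually (eventually_subset_edgesIn (shiftEdges y E))] with L hL hE
  linarith [(hν L).integral_sq_average_le hJ m hdisj hE p]

lemma real_inter_eq_mul_of_concentration [IsProbabilityMeasure μ]
    (hinv : ∀ x : Site d, MeasurePreserving (shift x) μ μ) {A B : Set (Current (Site d))}
    (hA : MeasurableSet A) (hAinv : ∀ x : Site d, shift x ⁻¹' A =ᵐ[μ] A) (hB : MeasurableSet B)
    {p : ℝ} (hconc : ∀ ε > 0, ∃ T : Finset (Site d), T.Nonempty ∧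
      ∫ ω, ((T.card : ℝ)⁻¹ * ∑ y ∈ T, (shift y ⁻¹' B).indicator 1 ω - p) ^ 2 ∂μ ≤ ε) :
    μ.real (A ∩ B) = μ.real A * p := by
  have hshift : ∀ y : Site d, μ.real (shift y ⁻¹' B ∩ A) = μ.real (A ∩ B) := fun y => by
    rw [Measure.real, Measure.real, ← (hinv y).measure_preimage (hA.inter hB).nullMeasurableSet,
      Set.preimage_inter, Set.inter_comm]
    exact congrArg _ (measure_congr ((hAinv y).symm.inter (ae_eq_refl _)))
  rw [← sub_eq_zero, ← abs_eq_zero]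
  refine le_antisymm (le_of_forall_pos_le_add fun ε hε => ?_) (abs_nonneg _)
  obtain ⟨T, hT, hsq⟩ := hconc (ε ^ 2) (by positivity)
  have hT0 : (T.card : ℝ) ≠ 0 := Nat.cast_ne_zero.2 hT.card_pos.ne'
  have hBy := fun y : Site d => measurable_shift y hB
  have hcov := abs_setIntegral_le_of_integral_sq_le (memLp_average_indicator_sub T hBy _ p) hε hsq A
  rw [setIntegral_average_indicator_sub T hBy] at hcov
  simpa only [hshift, Finset.sum_const, nsmul_eq_mul, inv_mul_cancel_left₀ hT0, zero_add,
    mul_comm p] using hcov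

lemma IsCurrentLaw.tendsto_real_shift_preimage_cyl (hJ : IsSummableCoupling J)
    (hν : ∀ L, IsCurrentLaw J β (h (box d L)) (box d L) (ν L)) {E : Finset (Edge (Site d))}
    {m : Current (Site d)} {p : ℝ} {x : Site d}
    (hp : Tendsto (fun L => isingMean J β (h (box d L)) (box d L)
      fun σ => cylFun J β E m (σ ∘ (· + x))) atTop (𝓝 p)) :
    Tendsto (fun L => (ν L).real (shift x ⁻¹' cyl E m)) atTop (𝓝 p) := by
  refine hp.congr' ?_
  filter_upwards [(tendsto_box d).eventually (eventually_subset_edgesIn (shiftEdges x E))]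
    with L hL
  exact ((hν L).real_shift_preimage_cyl hJ m hL).symm

theorem exists_isErgodicLimit (hJ : IsSummableCoupling J) (hh : IsMonotoneField J s h) (hβ : 0 < β)
    (hν : ∀ L, IsCurrentLaw J β (h (box d L)) (box d L) (ν L)) : ∃ μ, IsErgodicLimit ν μ := by
  have hprob := fun L => (hν L).isProbability
  choose p hp hconc using exists_cylFun_limit hJ hh hβ
  have hlim : ∀ E m x, Tendsto (fun L => (ν L).real (shift x ⁻¹' cyl E m)) atTop (𝓝 (p E m)) :=
    fun E m x => IsCurrentLaw.tendsto_real_shift_preimage_cyl hJ hν (hp E m x)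
  have hshift_zero : (shift 0 : Current (Site d) → Current (Site d)) = id := funext shift_zero
  obtain ⟨μ, hμprob, hμ⟩ := exists_limit_of_tendsto_cyl hprob
    (isTightMeasureSet_currentLaw (by rintro _ ⟨L, rfl⟩; exact ⟨_, _, hν L⟩))
    fun E m => ⟨p E m, by simpa only [hshift_zero, Set.preimage_id] using hlim E m 0⟩
  have hμcyl : ∀ E m x, μ.real (shift x ⁻¹' cyl E m) = p E m := fun E m x =>
    tendsto_nhds_unique (hμ.tendsto_real (dependsOn_shift_preimage_cyl x E m)) (hlim E m x)
  have hμcyl_zero : ∀ E m, μ.real (cyl E m) = p E m := fun E m => by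
    simpa only [hshift_zero, Set.preimage_id] using hμcyl E m 0
  have hinv : ∀ x : Site d, MeasurePreserving (shift x) μ μ := fun x => by
    have := Measure.isProbabilityMeasure_map (μ := μ) (measurable_shift x).aemeasurable
    refine ⟨measurable_shift x, measure_eq_of_cyl fun E m => ?_⟩
    rw [map_measureReal_apply (measurable_shift x) (measurableSet_cyl E m), hμcyl, hμcyl_zero]
  refine ⟨μ, hμprob, hμ, hinv, ?_⟩
  let := shiftAction d ℕ
  refine { measure_preimage_vadd := fun x A hA => (hinv x).measure_preimage hA.nullMeasurableSet
           aeconst_of_forall_preimage_vadd_ae_eq := fun {A} hA hAinv =>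
             eventuallyConst_of_indep_cyl hA fun E m => ?_ }
  rcases E.eq_empty_or_nonempty with rfl | ⟨e, -⟩
  · simp [cyl]
  · have := infinite_site e
    rw [hμcyl_zero]
    exact real_inter_eq_mul_of_concentration hinv hA hAinv (measurableSet_cyl E m) fun ε hε =>
      exists_integral_sq_average_le hJ hν hμ (hconc E m) hε

/-! ### Traces -/

lemma measurable_trace {V : Type} : Measurable (trace : Current V → Percolation V) :=
  measurable_pi_lambda _ fun e =>
    (measurable_of_countable fun k : ℕ => decide (0 < k)).comp (measurable_pi_apply e)

lemma IsErgodicLimit.map_trace (hμ : IsErgodicLimit ν μ) :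
    IsErgodicLimit (fun L => (ν L).map trace) (μ.map trace) := by
  have := hμ.isProbability
  have hpres : MeasurePreserving trace μ (μ.map trace) := measurable_trace.measurePreserving μ
  have hinv : ∀ x : Site d, MeasurePreserving (shift x) (μ.map trace) (μ.map trace) :=
    fun x => hpres.of_semiconj (hμ.invariance x) (fun _ => rfl) (measurable_shift x)
  refine ⟨Measure.isProbabilityMeasure_map measurable_trace.aemeasurable, fun E A hA => ?_, hinv,
    ?_⟩
  · have hAm : MeasurableSet A := (isClopen_of_dependsOn hA).isOpen.measurableSet
    simp only [Measure.map_apply measurable_trace hAm]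
    exact hμ.convergence E _ fun ω ω' hω => hA fun e he => by rw [trace, trace, hω e he]
  · let := shiftAction d Bool
    let := shiftAction d ℕ
    have herg : ErgodicVAdd (Site d) (Current (Site d)) μ := hμ.ergodicity
    refine { measure_preimage_vadd := fun x A hA => (hinv x).measure_preimage hA.nullMeasurableSet
             aeconst_of_forall_preimage_vadd_ae_eq := fun {A} hA hAinv => ?_ }
    have hconst := herg.aeconst_of_forall_preimage_vadd_ae_eq (measurable_trace hA) fun x =>
      hpres.quasiMeasurePreserving.preimage_ae_eq (hAinv x)
    rw [eventuallyConst_set', ae_eq_empty, ae_eq_univ] at hconst ⊢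
    rwa [Measure.map_apply measurable_trace hA, Measure.map_apply measurable_trace hA.compl]

end Ergodic

end RandomCurrent

end

theorem theorem2p2_general (d : ℕ) (J : Sym2 (RandomCurrent.Site d) → ℝ)
    (hJ : RandomCurrent.IsSummableCoupling J) (β : ℝ) (hβ : 0 < β) :
    ∃ P_plus P_free : Measure (RandomCurrent.Current (RandomCurrent.Site d)),
      (RandomCurrent.IsErgodicLimit (RandomCurrent.plusBoxLaw J β) P_plus ∧
        RandomCurrent.IsErgodicLimit (RandomCurrent.freeBoxLaw J β) P_free) ∧
      (RandomCurrent.IsErgodicLimit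
          (fun L => (RandomCurrent.plusBoxLaw J β L).map RandomCurrent.trace)
          (P_plus.map RandomCurrent.trace) ∧
        RandomCurrent.IsErgodicLimit
          (fun L => (RandomCurrent.freeBoxLaw J β L).map RandomCurrent.trace)
          (P_free.map RandomCurrent.trace)) := by
  obtain ⟨P_plus, hplus⟩ := RandomCurrent.exists_isErgodicLimit
    (ν := RandomCurrent.plusBoxLaw J β) hJ hJ.isMonotoneField_ghostCoupling hβ
    fun L => RandomCurrent.isCurrentLaw_plus hJ.nonneg hβ.le _
  obtain ⟨P_free, hfree⟩ := RandomCurrent.exists_isErgodicLimit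
    (ν := RandomCurrent.freeBoxLaw J β) hJ hJ.isMonotoneField_zero hβ
    fun L => RandomCurrent.isCurrentLaw_free hJ.nonneg hβ.le _
  exact ⟨P_plus, P_free, ⟨hplus, hfree⟩, hplus.map_trace, hfree.map_trace⟩

theorem theorem2p2 (d : ℕ) (J : Sym2 (RandomCurrent.Site d) → ℝ)
    (hJ : RandomCurrent.IsCoupling J) (β : ℝ) (hβ : 0 < β) :
    ∃ P_plus P_free : Measure (RandomCurrent.Current (RandomCurrent.Site d)),
      (RandomCurrent.IsErgodicLimit (RandomCurrent.plusBoxLaw J β) P_plus ∧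
        RandomCurrent.IsErgodicLimit (RandomCurrent.freeBoxLaw J β) P_free) ∧
      (RandomCurrent.IsErgodicLimit
          (fun L => (RandomCurrent.plusBoxLaw J β L).map RandomCurrent.trace)
          (P_plus.map RandomCurrent.trace) ∧
        RandomCurrent.IsErgodicLimit
          (fun L => (RandomCurrent.freeBoxLaw J β L).map RandomCurrent.trace)
          (P_free.map RandomCurrent.trace)) :=
  theorem2p2_general d J ⟨hJ.translation, Sym2.ind hJ.nonneg, hJ.summable⟩ β hβ
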